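/- Let $p$ be a prime, let $v_p$ be the valuation on $\mathbb{C}_p$ with $v_p(p)=1$ and $v_p(0)=+\infty$, and let $|\cdot|_p$ be the corresponding absolute value. Let $N\ge 0$ and $d\ge 2$ be integers and let $c_1,c_2\in\mathbb{C}_p$. Assume that one of the following two conditions holds: (A) $N=0$, $d$ is a multiple of $p$, and $v_p(c_2)<v_p(d)+\dfrac{v_p((d-1)!)}{d-1}$; (B) $N\ge 1$, $d$ is a power of $p$, and $Nv_p(d)+\dfrac{v_p((d-1)!)}{d-1}<v_p(c_2)<(N+1)v_p(d)+\dfrac{v_p((d-1)!)}{d-1}$. Assume moreover that $v_p(c_1)\ge 0$ and $v_p(c_1^{d-1}-c_2^{d-1})=v_p(c_2^{d-1})$. For $c\in\mathbb{C}_p$ let $f_c(z)=z^d-c$, and let $B(c)=\{z\in\mathbb{C}_p: |f_c^{\circ n}(z)|_p\to\infty \text{ as } n\to\infty\}$ be its basin of infinity. A function $F:B(c)\to\mathbb{C}_p$ is called analytic if it is rigid analytic, that is, if for every set $X\subseteq B(c)$ which is a closed disk $\{|z-a|_p\le|\rho|_p\}$ minus finitely many open disks $\{|z-b_i|_p<|\sigma_i|_p\}$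 (with $a,b_i\in\mathbb{C}_p$ and $\rho,\sigma_i\in\mathbb{C}_p^{\times}$), the restriction $F|_X$ is a uniform limit of rational functions over $\mathbb{C}_p$ without poles in $X$. Then $B(c_1)$ and $B(c_2)$ are not analytically conjugate: there is no bijective analytic map $\Phi:B(c_1)\to B(c_2)$ with analytic inverse such that $f_{c_2}(\Phi(z))=\Phi(f_{c_1}(z))$ for all $z\in B(c_1)$. -/

import Mathlib

noncomputable section

namespace WildBottcher

variable (p : ℕ) [hp : Fact p.Prime]

/-- The `p`-adic valuation `v_p` on `ℂ_p`, normalized by `v_p(p) = 1`, with `v_p(0) = +∞`. -/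
def vp (x : ℂ_[p]) : EReal :=
  open Classical in if x = 0 then ⊤ else ((-Real.logb (p : ℝ) ‖x‖ : ℝ) : EReal)

/-- The real number `k * v_p(d) + v_p((d-1)!) / (d-1)`. -/
def threshold (k d : ℕ) : ℝ :=
  (k : ℝ) * (padicValNat p d : ℝ) + (padicValNat p (d - 1).factorial : ℝ) / ((d : ℝ) - 1)

/-- Condition A: `N = 0`, `d` is a multiple of `p`, and
`v_p(c) < v_p(d) + v_p((d-1)!)/(d-1)`. -/
def ConditionA (N d : ℕ) (c : ℂ_[p]) : Prop :=
  N = 0 ∧ p ∣ d ∧ vp p c < (threshold p 1 d : EReal)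

/-- Condition B: `N ≥ 1`, `d` is a power of `p`, and
`N v_p(d) + v_p((d-1)!)/(d-1) < v_p(c) < (N+1) v_p(d) + v_p((d-1)!)/(d-1)`. -/
def ConditionB (N d : ℕ) (c : ℂ_[p]) : Prop :=
  1 ≤ N ∧ (∃ k : ℕ, 1 ≤ k ∧ d = p ^ k) ∧
    (threshold p N d : EReal) < vp p c ∧ vp p c < (threshold p (N + 1) d : EReal)

variable {p}

/-- The polynomial map `f_c(z) = z^d - c`. -/
def f (d : ℕ) (c z : ℂ_[p]) : ℂ_[p] := z ^ d - c

/-- The basin of infinity `B(c)` of `f_c`, as a subset of `ℂ_p`. -/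
def basin (d : ℕ) (c : ℂ_[p]) : Set ℂ_[p] :=
  {z | Filter.Tendsto (fun n : ℕ => ‖(f d c)^[n] z‖) Filter.atTop Filter.atTop}

/-- Connected affinoid subsets of the affine line: a closed disk `|z - a| ≤ |ρ|` minus
finitely many open disks `|z - b| < |σ|`, one for each pair `(b, σ)` in `H`,
where all the radii `|ρ|`, `|σ|` belong to the value group `|ℂ_p^×|`. -/
def IsAffinoid (X : Set ℂ_[p]) : Prop :=
  ∃ (a ρ : ℂ_[p]) (H : Finset (ℂ_[p] × ℂ_[p])), ρ ≠ 0 ∧ (∀ h ∈ H, h.2 ≠ 0) ∧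
    X = {z | ‖z - a‖ ≤ ‖ρ‖ ∧ ∀ h ∈ H, ‖h.2‖ ≤ ‖z - h.1‖}

/-- `F` is (rigid) analytic on the affinoid `X`: it is a uniform limit on `X` of rational
functions without poles in `X`. -/
def AnalyticOnAffinoid (F : ℂ_[p] → ℂ_[p]) (X : Set ℂ_[p]) : Prop :=
  ∀ ε : ℝ, 0 < ε → ∃ P Q : Polynomial ℂ_[p],
    ∀ z ∈ X, Q.eval z ≠ 0 ∧ ‖F z - P.eval z / Q.eval z‖ < ε

/-- `F` is (rigid) analytic on `U`: its restriction to each affinoid contained in `U` is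
analytic. -/
def RigidAnalyticOn (F : ℂ_[p] → ℂ_[p]) (U : Set ℂ_[p]) : Prop :=
  ∀ X : Set ℂ_[p], IsAffinoid X → X ⊆ U → AnalyticOnAffinoid F X

/-- The basins `B(c₁)` and `B(c₂)` are analytically conjugate: there is a bijective analytic map
`Φ : B(c₁) → B(c₂)` with analytic inverse `Ψ` such that `f_{c₂} ∘ Φ = Φ ∘ f_{c₁}` on `B(c₁)`.
The values of `Φ` and `Ψ` off the basins are irrelevant. -/
def AnalyticallyConjugate (d : ℕ) (c₁ c₂ : ℂ_[p]) : Prop :=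
  ∃ Φ Ψ : ℂ_[p] → ℂ_[p],
    Set.BijOn Φ (basin d c₁) (basin d c₂) ∧
    Set.InvOn Ψ Φ (basin d c₁) (basin d c₂) ∧
    RigidAnalyticOn Φ (basin d c₁) ∧
    RigidAnalyticOn Ψ (basin d c₂) ∧
    ∀ z ∈ basin d c₁, f d c₂ (Φ z) = Φ (f d c₁ z)

end WildBottcher

end

/-!
Write `m = v_p(d)`, `v = v_p(c₂)` and `τ = 1 / (p - 1) - m / (d - 1)`. Legendre's formula gives
`v_p((d - 1)!) / (d - 1) ≤ τ`, with equality when `d` is a power of `p`, so either condition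
implies `N m + τ < v < (N + 1) m + τ`, the lower bound being void for `N = 0` (`condition_bounds`).

If `‖c₂‖ > 1`, the critical point `0` lies in `B(c₂)`, so `-c₂ ∈ B(c₂)` has a single preimage under
`f_{c₂}`, while every point of `B(c₁) = {‖z‖ > 1}` has `d` preimages; no bijection conjugates the
two maps (`not_conjugate_of_one_lt_norm`).

If `‖c₂‖ ≤ 1`, both basins are `{‖z‖ > 1}`. A conjugacy `Φ` and its inverse have no zeros, so their
norms are monomials in `‖z‖`, and the functional equation forces `‖Φ z‖ = ‖z‖` (`norm_conjugacy`).
Hence `Φ z / z` is a power series in `x = 1 / z` with integral coefficients (`exists_powerSeries`)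
whose constant term `l` satisfies `l ^ (d - 1) = 1`. Writing `Φ z = l z (1 + A x)` and
`e = c₂ / l - c₁`, which has the size of `c₂`, the conjugacy becomes
`(1 + A x) ^ d - 1 = e x ^ d + (1 - c₁ x ^ d) A (x ^ d / (1 - c₁ x ^ d))`
(`IsBottcherSolution`).

This is contradicted by a Newton polygon argument (`false_of_crossing`). Let
`κ = p ^ (-1 / (p - 1))` be the least distance from `1` to another `d`-th root of unity. Below
`κ`, the map `y ↦ (1 + y) ^ d - 1` scales norms by `‖d‖`, so from small radii outwards, and as
long as they stay below `κ`, the monomials `(e / d ^ (n + 1)) x ^ (d ^ (n + 1))` bound `A`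
(`upper_bound`), and where one of them strictly dominates it gives the exact size of `A`
(`norm_eq_levelTerm`). The bounds on `v` say that `κ` is reached at a radius where the `N`-th
monomial strictly dominates. Beyond that radius convexity forces the logarithm of the size of `A`
to keep growing with slope at least `d ^ (N + 1)`. But the right side of the equation still grows
with slope exactly `d ^ (N + 1)`, while above `κ` the size of `(1 + A) ^ d - 1` increases faster
than that of `A`, because at least one further factor `1 + A - ζ` starts to grow (`term_bound`).
-/

namespace WildBottcher

open Polynomial Filter Topology

/-! ### Norms in an algebraically closed ultrametric field -/

section Ultrametric

variable {K : Type*} [NontriviallyNormedField K]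

lemma norm_eq_one_of_pow {w : K} {n : ℕ} (hn : n ≠ 0) (h : w ^ n = 1) : ‖w‖ = 1 := by
  have := congrArg norm h
  rwa [norm_pow, norm_one, pow_eq_one_iff_of_nonneg (norm_nonneg _) hn] at this

/-- The value group is dense. -/
lemma exists_norm_between [IsAlgClosed K] {a b : ℝ} (ha : 0 < a) (hab : a < b) :
    ∃ x : K, x ≠ 0 ∧ a < ‖x‖ ∧ ‖x‖ < b := by
  obtain ⟨y, hy⟩ := NormedField.exists_one_lt_norm K
  set L := Real.log ‖y‖ with hL
  have hL0 : 0 < L := Real.log_pos hy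
  have hlog : Real.log a < Real.log b := Real.log_lt_log ha hab
  obtain ⟨q, hq1, hq2⟩ := exists_rat_btwn (div_lt_div_of_pos_right hlog hL0)
  have hy0 : y ≠ 0 := fun h => by simp [h] at hy; linarith
  obtain ⟨x, hx⟩ := IsAlgClosed.exists_pow_nat_eq (y ^ q.num) q.den_pos
  have hx0 : x ≠ 0 := by
    rintro rfl
    rw [zero_pow q.den_nz] at hx
    exact zpow_ne_zero _ hy0 hx.symm
  have hxl : Real.log ‖x‖ = q * L := by
    have h := congrArg (fun t => Real.log ‖t‖) hx
    simp only [norm_pow, norm_zpow, Real.log_pow, Real.log_zpow] at h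
    have hd : (q.den : ℝ) ≠ 0 := by exact_mod_cast q.den_nz
    have hq : (q : ℝ) = q.num / q.den := by exact_mod_cast (Rat.num_div_den q).symm
    rw [hq, div_mul_eq_mul_div, ← h]
    field_simp
  have hxp : 0 < ‖x‖ := norm_pos_iff.2 hx0
  refine ⟨x, hx0, ?_, ?_⟩
  · rw [← Real.log_lt_log_iff ha hxp, hxl]
    rwa [div_lt_iff₀ hL0] at hq1
  · rw [← Real.log_lt_log_iff hxp (ha.trans hab), hxl]
    rwa [lt_div_iff₀ hL0] at hq2

/-- The derivative of `X ^ d - 1` at `1`, computed from its factorization. -/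
lemma prod_norm_one_sub [DecidableEq K] [IsAlgClosed K] [CharZero K] {d : ℕ} (hd : 0 < d) :
    ∏ w ∈ (nthRootsFinset d (1 : K)).erase 1, ‖1 - w‖ = ‖(d : K)‖ := by
  have : NeZero (d : K) := ⟨by exact_mod_cast hd.ne'⟩
  obtain ⟨ζ, hζ⟩ := HasEnoughRootsOfUnity.exists_primitiveRoot K d
  have h := X_pow_sub_one_eq_prod hd hζ
  have h1 : (1 : K) ∈ nthRootsFinset d (1 : K) := by simp [mem_nthRootsFinset hd]
  rw [← Finset.mul_prod_erase _ _ h1] at h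
  have h2 := congrArg (fun P => eval 1 (derivative P)) h
  simp [derivative_mul, eval_prod, derivative_X_pow] at h2
  rw [h2, norm_prod]

variable [IsUltrametricDist K]

lemma norm_add_lt_of_lt {x y : K} {c : ℝ} (hx : ‖x‖ < c) (hy : ‖y‖ < c) : ‖x + y‖ < c :=
  (IsUltrametricDist.norm_add_le_max x y).trans_lt (max_lt hx hy)

lemma norm_add_le_of_le {x y : K} {c : ℝ} (hx : ‖x‖ ≤ c) (hy : ‖y‖ ≤ c) : ‖x + y‖ ≤ c :=
  (IsUltrametricDist.norm_add_le_max x y).trans (max_le hx hy)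

lemma norm_sub_le_of_le {x y : K} {c : ℝ} (hx : ‖x‖ ≤ c) (hy : ‖y‖ ≤ c) : ‖x - y‖ ≤ c :=
  sub_eq_add_neg x y ▸ norm_add_le_of_le hx (by rwa [norm_neg])

lemma norm_sub_lt_of_lt {x y : K} {c : ℝ} (hx : ‖x‖ < c) (hy : ‖y‖ < c) : ‖x - y‖ < c :=
  sub_eq_add_neg x y ▸ norm_add_lt_of_lt hx (by rwa [norm_neg])

lemma norm_add_eq_left {x y : K} (h : ‖y‖ < ‖x‖) : ‖x + y‖ = ‖x‖ := by
  rw [IsUltrametricDist.norm_add_eq_max_of_norm_ne_norm h.ne', max_eq_left h.le]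

lemma norm_sub_eq_left {x y : K} (h : ‖y‖ < ‖x‖) : ‖x - y‖ = ‖x‖ := by
  rw [sub_eq_add_neg, norm_add_eq_left (by rwa [norm_neg])]

lemma norm_sub_eq_right {x y : K} (h : ‖x‖ < ‖y‖) : ‖x - y‖ = ‖y‖ := by
  rw [norm_sub_rev, norm_sub_eq_left h]

lemma hasSum_norm_le {a : ℕ → K} {s : K} {c : ℝ} (h : HasSum a s) (hc : ∀ k, ‖a k‖ ≤ c) :
    ‖s‖ ≤ c := by
  rw [← h.tsum_eq]
  exact IsUltrametricDist.norm_tsum_le_of_forall_le hc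

/-! ### Roots of unity -/

lemma norm_one_sub_pow_le {w : K} (hw : ‖w‖ = 1) (n : ℕ) : ‖1 - w ^ n‖ ≤ ‖1 - w‖ := by
  have h : (1 - w ^ n : K) = (1 - w) * ∑ i ∈ Finset.range n, w ^ i := by
    rw [mul_neg_geom_sum]
  rw [h, norm_mul]
  refine mul_le_of_le_one_right (norm_nonneg _) ?_
  refine IsUltrametricDist.norm_sum_le_of_forall_le_of_nonneg zero_le_one fun i _ => ?_
  rw [norm_pow, hw, one_pow]

/-- If the order of `w` is invertible in the ring of integers, `w` is far from `1`. -/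
lemma norm_one_sub_eq_one {w : K} {n : ℕ} (hn : ‖(n : K)‖ = 1) (h : IsPrimitiveRoot w n)
    {i : ℕ} (hi : 0 < i) (hin : i < n) : ‖1 - w ^ i‖ = 1 := by
  obtain ⟨m, rfl⟩ : ∃ m, n = m + 1 := ⟨n - 1, by omega⟩
  have hw := norm_eq_one_of_pow (by omega) h.pow_eq_one
  have hle : ∀ k, ‖1 - w ^ k‖ ≤ 1 := fun k =>
    norm_sub_le_of_le norm_one.le (by rw [norm_pow, hw, one_pow])
  have hprod := congrArg norm h.prod_one_sub_pow_eq_order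
  rw [norm_prod] at hprod
  push_cast at hn
  rw [hn] at hprod
  refine (hle i).antisymm ?_
  rw [← hprod, ← Finset.mul_prod_erase _ _ (Finset.mem_range.2 (show i - 1 < m by omega)),
    Nat.sub_add_cancel hi]
  exact mul_le_of_le_one_right (norm_nonneg _)
    (Finset.prod_le_one (fun _ _ => norm_nonneg _) fun _ _ => hle _)

/-- The `l - 1` conjugates `1 - w ^ k` all have the same norm, and their product is `l`. -/
lemma norm_one_sub_pow_prime {w : K} {l : ℕ} (hl : l.Prime) (h : IsPrimitiveRoot w l) :
    ‖1 - w‖ ^ (l - 1) = ‖(l : K)‖ := by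
  obtain ⟨m, rfl⟩ : ∃ m, l = m + 1 := ⟨l - 1, by have := hl.pos; omega⟩
  have hw := norm_eq_one_of_pow (by omega) h.pow_eq_one
  have hprod := congrArg norm h.prod_one_sub_pow_eq_order
  rw [norm_prod] at hprod
  push_cast
  rw [← hprod, Finset.prod_congr rfl (g := fun _ => ‖1 - w‖), Finset.prod_const,
    Finset.card_range]
  intro k hk
  refine (norm_one_sub_pow_le hw _).antisymm ?_
  have hco : (k + 1).Coprime (m + 1) :=
    (Nat.coprime_of_lt_prime (by omega) (by have := Finset.mem_range.1 hk; omega) hl).symm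
  have hk' := h.pow_of_coprime _ hco
  obtain ⟨i, -, hi⟩ := hk'.eq_pow_of_pow_eq_one h.pow_eq_one
  calc ‖1 - w‖ = ‖1 - (w ^ (k + 1)) ^ i‖ := by rw [hi]
    _ ≤ _ := norm_one_sub_pow_le (by rw [norm_pow, hw, one_pow]) i

/-- Arbitrarily many points of the unit circle that lie in distinct residue classes. -/
lemma exists_separated_units [IsAlgClosed K] [CharZero K] (n : ℕ) :
    ∃ S : Finset K, n ≤ S.card ∧ (∀ t ∈ S, ‖t‖ = 1) ∧
      ∀ t ∈ S, ∀ t' ∈ S, t ≠ t' → ‖t - t'‖ = 1 := by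
  -- one of two consecutive integers is a unit of the ring of integers
  obtain ⟨m, hnm, hm0, hm⟩ : ∃ m, n ≤ m ∧ 0 < m ∧ ‖(m : K)‖ = 1 := by
    by_cases h : ‖((n + 1 : ℕ) : K)‖ = 1
    · exact ⟨n + 1, by omega, by omega, h⟩
    · refine ⟨n + 2, by omega, by omega, ?_⟩
      have h' : ‖((n + 1 : ℕ) : K)‖ < 1 :=
        lt_of_le_of_ne (IsUltrametricDist.norm_natCast_le_one K _) h
      have : ((n + 2 : ℕ) : K) = 1 + ((n + 1 : ℕ) : K) := by push_cast; ring
      rw [this, norm_add_eq_left (by rwa [norm_one]), norm_one]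
  have : NeZero (m : K) := ⟨by exact_mod_cast hm0.ne'⟩
  obtain ⟨ζ, hζ⟩ := HasEnoughRootsOfUnity.exists_primitiveRoot K m
  have hζ1 := norm_eq_one_of_pow hm0.ne' hζ.pow_eq_one
  classical
  refine ⟨(Finset.range m).image (ζ ^ ·), ?_, ?_, ?_⟩
  · rw [Finset.card_image_of_injOn, Finset.card_range]
    · exact hnm
    · intro i hi j hj hij
      exact hζ.pow_inj (by simpa using hi) (by simpa using hj) hij
  · intro t ht
    obtain ⟨i, -, rfl⟩ := Finset.mem_image.1 ht
    simp [hζ1]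
  · intro t ht t' ht' hne
    obtain ⟨i, hi, rfl⟩ := Finset.mem_image.1 ht
    obtain ⟨j, hj, rfl⟩ := Finset.mem_image.1 ht'
    rw [Finset.mem_range] at hi hj
    have key : ∀ i j, i < j → j < m → ‖ζ ^ i - ζ ^ j‖ = 1 := by
      intro i j hij hj
      have : ζ ^ i - ζ ^ j = ζ ^ i * (1 - ζ ^ (j - i)) := by
        rw [mul_sub, mul_one, ← pow_add, Nat.add_sub_cancel' hij.le]
      rw [this, norm_mul, norm_pow, hζ1, one_pow, one_mul]
      exact norm_one_sub_eq_one hm hζ (by omega) (by omega)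
    rcases lt_trichotomy i j with h | h | h
    · exact key i j h hj
    · exact absurd (by rw [h]) hne
    · rw [norm_sub_rev]; exact key j i h hi

/-! ### Sizes of coefficients and of values -/

/-- A polynomial that is small at more residue classes than its degree has small coefficients. -/
lemma coeff_norm_lt_of_forall_mem {δ : ℝ} (n : ℕ) : ∀ (P : K[X]) (S : Finset K),
    P.natDegree ≤ n → n < S.card → (∀ t ∈ S, ‖t‖ ≤ 1) →
    (∀ t ∈ S, ∀ t' ∈ S, t ≠ t' → ‖t - t'‖ = 1) → (∀ t ∈ S, ‖P.eval t‖ < δ) →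
    ∀ k, ‖P.coeff k‖ < δ := by
  classical
  induction n with
  | zero =>
    intro P S hP hS _ _ h k
    obtain ⟨t, ht⟩ := Finset.card_pos.1 hS
    have hδ : 0 < δ := (norm_nonneg _).trans_lt (h t ht)
    rw [eq_C_of_natDegree_le_zero hP] at h ⊢
    rw [coeff_C]
    split_ifs
    · simpa using h t ht
    · simpa using hδ
  | succ n ih =>
    intro P S hP hS h1 hsep h k
    obtain ⟨t, ht⟩ := Finset.card_pos.1 ((Nat.succ_pos n).trans hS)
    have hδ : 0 < δ := (norm_nonneg _).trans_lt (h t ht)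
    have hdiv : P = (X - C t) * (P /ₘ (X - C t)) + C (P.eval t) := by
      conv_lhs => rw [← modByMonic_add_div P (X - C t), modByMonic_X_sub_C_eq_C_eval]
      ring
    set Q := P /ₘ (X - C t) with hQ
    have hQdeg : Q.natDegree ≤ n := by
      rw [hQ, natDegree_divByMonic _ (monic_X_sub_C t), natDegree_X_sub_C]; omega
    have hQc := ih Q (S.erase t) hQdeg (by rw [Finset.card_erase_of_mem ht]; omega)
      (fun s hs => h1 s (Finset.mem_of_mem_erase hs))
      (fun s hs s' hs' => hsep s (Finset.mem_of_mem_erase hs) s' (Finset.mem_of_mem_erase hs'))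
      (fun s hs => by
        have hst := hsep s (Finset.mem_of_mem_erase hs) t ht (Finset.ne_of_mem_erase hs)
        have he : (s - t) * Q.eval s = P.eval s - P.eval t := by
          conv_rhs => rw [hdiv]
          simp
        have := norm_sub_lt_of_lt (h s (Finset.mem_of_mem_erase hs)) (h t ht)
        rwa [← he, norm_mul, hst, one_mul] at this)
    have hX : ‖((X - C t) * Q).coeff k‖ < δ := by
      rw [sub_mul, coeff_sub, coeff_C_mul]
      refine norm_sub_lt_of_lt ?_ ?_
      · cases k with
        | zero => simpa using hδ
        | succ k => rw [coeff_X_mul]; exact hQc k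
      · rw [norm_mul]
        exact (mul_le_of_le_one_left (norm_nonneg _) (h1 t ht)).trans_lt (hQc k)
    rw [hdiv, coeff_add]
    refine norm_add_lt_of_lt hX ?_
    rw [coeff_C]
    split_ifs
    · exact h t ht
    · simpa using hδ

/-- **Cauchy estimate** for polynomials. -/
lemma coeff_norm_mul_pow_le [IsAlgClosed K] [CharZero K] (P : K[X]) {x₀ : K} {δ : ℝ}
    (h : ∀ x, ‖x‖ = ‖x₀‖ → ‖P.eval x‖ ≤ δ) (k : ℕ) : ‖P.coeff k‖ * ‖x₀‖ ^ k ≤ δ := by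
  refine le_of_forall_gt_imp_ge_of_dense fun δ' hδ' => ?_
  obtain ⟨S, hc, h1, hs⟩ := exists_separated_units (K := K) ((P.comp (C x₀ * X)).natDegree + 1)
  have := coeff_norm_lt_of_forall_mem (δ := δ') _ (P.comp (C x₀ * X)) S le_rfl hc
    (fun t ht => (h1 t ht).le) hs (fun t ht => by
      rw [eval_comp]
      refine (h _ ?_).trans_lt hδ'
      simp [h1 t ht]) k
  rw [comp_C_mul_X_coeff, norm_mul, norm_pow] at this
  exact this.le

/-- On a circle there is a point at which finitely many given convergent power series are at least
as large as any prescribed one of their terms. -/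
lemma exists_generic_point [IsAlgClosed K] [CharZero K] {ι : Type*} (I : Finset ι)
    (a : ι → ℕ → K) (F : ι → K → K) (n : ι → ℕ) (x₀ : K)
    (hF : ∀ i ∈ I, ∀ x, ‖x‖ = ‖x₀‖ → HasSum (fun k => a i k * x ^ k) (F i x)) :
    ∃ x, ‖x‖ = ‖x₀‖ ∧ ∀ i ∈ I, ‖a i (n i)‖ * ‖x₀‖ ^ n i ≤ ‖F i x‖ := by
  classical
  set B : ι → ℝ := fun i => ‖a i (n i)‖ * ‖x₀‖ ^ n i with hB
  have hN : ∀ i ∈ I, ∃ N, 0 < B i → ∀ k ≥ N, ‖a i k‖ * ‖x₀‖ ^ k ≤ B i / 2 := by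
    intro i hi
    by_cases hb : 0 < B i
    · have h0 := (hF i hi x₀ rfl).summable.tendsto_atTop_zero.norm
      rw [norm_zero] at h0
      obtain ⟨N, hN⟩ := eventually_atTop.1 (h0.eventually_lt_const (half_pos hb))
      exact ⟨N, fun _ k hk => by simpa using (hN k hk).le⟩
    · exact ⟨0, fun h => absurd h hb⟩
  choose! N hN using hN
  -- the truncation of the `i`-th series, in the coordinate `x = x₀ t`
  let P : ι → K[X] := fun i => ∑ k ∈ Finset.range (N i), C (a i k * x₀ ^ k) * X ^ k
  have hPc : ∀ i k, (P i).coeff k = if k < N i then a i k * x₀ ^ k else 0 := by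
    intro i k
    simp only [P, finsetSum_coeff, coeff_C_mul, coeff_X_pow, mul_ite, mul_one, mul_zero,
      Finset.sum_ite_eq, Finset.mem_range]
  have hPF : ∀ i ∈ I, 0 < B i → ∀ t, ‖t‖ = 1 → ‖F i (x₀ * t)‖ < B i →
      ‖(P i).eval t‖ < B i := by
    intro i hi hb t ht hlt
    have hs := hF i hi (x₀ * t) (by simp [ht])
    have h2 := (hasSum_nat_add_iff' (N i)).2 hs
    have h3 : ‖F i (x₀ * t) - ∑ k ∈ Finset.range (N i), a i k * (x₀ * t) ^ k‖ ≤ B i / 2 :=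
      hasSum_norm_le h2 fun k => by
        simpa [ht] using hN i hi hb (k + N i) (Nat.le_add_left _ _)
    have he : (P i).eval t = ∑ k ∈ Finset.range (N i), a i k * (x₀ * t) ^ k := by
      simp only [P, eval_finsetSum, eval_mul, eval_C, eval_pow, eval_X]
      exact Finset.sum_congr rfl fun k _ => by ring
    rw [he, ← sub_sub_self (F i (x₀ * t)) (∑ k ∈ Finset.range (N i), a i k * (x₀ * t) ^ k)]
    exact norm_sub_lt_of_lt hlt (h3.trans_lt (half_lt_self hb))
  obtain ⟨S, hc, h1, hs⟩ :=
    exists_separated_units (K := K) ((∑ i ∈ I, ((P i).natDegree + 1)) + 1)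
  let bad : ι → Finset K := fun i => S.filter fun t => ‖F i (x₀ * t)‖ < B i
  have hbad : ∀ i ∈ I, (bad i).card ≤ (P i).natDegree + 1 := by
    intro i hi
    by_contra! hcard
    obtain ⟨t₀, ht₀⟩ := Finset.card_pos.1 ((Nat.zero_le _).trans_lt hcard)
    have hb : 0 < B i := (norm_nonneg _).trans_lt (Finset.mem_filter.1 ht₀).2
    have hco := coeff_norm_lt_of_forall_mem (δ := B i) _ (P i) (bad i) le_rfl (by omega)
      (fun t ht => (h1 t (Finset.mem_filter.1 ht).1).le)
      (fun t ht t' ht' => hs t (Finset.mem_filter.1 ht).1 t' (Finset.mem_filter.1 ht').1)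
      (fun t ht => hPF i hi hb t (h1 t (Finset.mem_filter.1 ht).1) (Finset.mem_filter.1 ht).2)
      (n i)
    have hlt : n i < N i := by
      by_contra! hge
      have := hN i hi hb (n i) hge
      have h2 := half_lt_self hb
      exact absurd this (not_le.2 h2)
    rw [hPc, if_pos hlt, norm_mul, norm_pow] at hco
    exact lt_irrefl _ hco
  have hex : ∃ t ∈ S, t ∉ I.biUnion bad := by
    by_contra! hall
    have h2 := Finset.card_le_card (show S ⊆ I.biUnion bad from hall)
    have h3 := (Finset.card_biUnion_le (s := I) (t := bad)).trans (Finset.sum_le_sum hbad)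
    omega
  obtain ⟨t, htS, htb⟩ := hex
  refine ⟨x₀ * t, by simp [h1 t htS], fun i hi => ?_⟩
  by_contra! hlt
  exact htb (Finset.mem_biUnion.2 ⟨i, hi, Finset.mem_filter.2 ⟨htS, hlt⟩⟩)

end Ultrametric

/-! ### Laurent approximation and removable singularities -/

section LaurentExpansion

variable {K : Type*} [NontriviallyNormedField K]

/-- `F` is a uniform limit of Laurent polynomials `P(z) / z ^ m` on the annulus
`s ≤ ‖z‖ ≤ S`. -/
def LaurentApprox (F : K → K) (s S : ℝ) : Prop :=
  ∀ ε : ℝ, 0 < ε → ∃ (P : K[X]) (m : ℕ), ∀ z, s ≤ ‖z‖ → ‖z‖ ≤ S →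
    ‖F z - P.eval z / z ^ m‖ < ε

lemma laurent_bounded (P : K[X]) (m : ℕ) {s S : ℝ} (hs : 0 < s) :
    ∃ C : ℝ, 0 < C ∧ ∀ z, s ≤ ‖z‖ → ‖z‖ ≤ S → ‖P.eval z / z ^ m‖ ≤ C := by
  refine ⟨(∑ i ∈ Finset.range (P.natDegree + 1), ‖P.coeff i‖ * |S| ^ i) / s ^ m + 1, ?_, ?_⟩
  · positivity
  · intro z hz1 hz2
    refine le_trans ?_ (le_add_of_nonneg_right zero_le_one)
    rw [norm_div, norm_pow, eval_eq_sum_range]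
    refine div_le_div₀ (Finset.sum_nonneg fun i _ => by positivity) ?_ (by positivity)
      (pow_le_pow_left₀ hs.le hz1 m)
    refine (norm_sum_le _ _).trans (Finset.sum_le_sum fun i _ => ?_)
    rw [norm_mul, norm_pow]
    exact mul_le_mul_of_nonneg_left
      (pow_le_pow_left₀ (norm_nonneg _) (hz2.trans (le_abs_self S)) i) (norm_nonneg _)

lemma laurentApprox_polynomial (P : K[X]) (s S : ℝ) :
    LaurentApprox (fun z => P.eval z) s S :=
  fun ε hε => ⟨P, 0, fun z _ _ => by simpa using hε⟩

variable [IsUltrametricDist K]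

lemma LaurentApprox.bounded {F : K → K} {s S : ℝ} (hs : 0 < s) (h : LaurentApprox F s S) :
    ∃ C : ℝ, 0 < C ∧ ∀ z, s ≤ ‖z‖ → ‖z‖ ≤ S → ‖F z‖ ≤ C := by
  obtain ⟨P, m, hP⟩ := h 1 one_pos
  obtain ⟨C, hC, hPC⟩ := laurent_bounded P m (S := S) hs
  refine ⟨max 1 C, by positivity, fun z h1 h2 => ?_⟩
  rw [← sub_add_cancel (F z) (P.eval z / z ^ m)]
  exact norm_add_le_of_le ((hP z h1 h2).le.trans (le_max_left _ _))
    ((hPC z h1 h2).trans (le_max_right _ _))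

lemma LaurentApprox.mul {F G : K → K} {s S : ℝ} (hs : 0 < s) (hF : LaurentApprox F s S)
    (hG : LaurentApprox G s S) : LaurentApprox (fun z => F z * G z) s S := by
  intro ε hε
  obtain ⟨C, hC, hGC⟩ := hG.bounded hs
  obtain ⟨P, m, hP⟩ := hF (ε / C) (div_pos hε hC)
  obtain ⟨D, hD, hPD⟩ := laurent_bounded P m (S := S) hs
  obtain ⟨Q, n, hQ⟩ := hG (ε / D) (div_pos hε hD)
  refine ⟨P * Q, m + n, fun z h1 h2 => ?_⟩
  have he : F z * G z - (P * Q).eval z / z ^ (m + n)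
      = (F z - P.eval z / z ^ m) * G z + P.eval z / z ^ m * (G z - Q.eval z / z ^ n) := by
    rw [eval_mul, pow_add, mul_div_mul_comm]; ring
  rw [he]
  refine norm_add_lt_of_lt ?_ ?_
  · rw [norm_mul]
    calc _ ≤ ‖F z - P.eval z / z ^ m‖ * C :=
          mul_le_mul_of_nonneg_left (hGC z h1 h2) (norm_nonneg _)
      _ < ε / C * C := mul_lt_mul_of_pos_right (hP z h1 h2) hC
      _ = ε := div_mul_cancel₀ _ hC.ne'
  · rw [norm_mul]
    calc _ ≤ D * ‖G z - Q.eval z / z ^ n‖ :=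
          mul_le_mul_of_nonneg_right (hPD z h1 h2) (norm_nonneg _)
      _ < D * (ε / D) := mul_lt_mul_of_pos_left (hQ z h1 h2) hD
      _ = ε := mul_div_cancel₀ _ hD.ne'

/-- The geometric series expands `1 / (z - β)` on both sides of the circle `‖z‖ = ‖β‖`. -/
lemma laurentApprox_inv_sub {β : K} {s S : ℝ} (hs : 0 < s) (hβ : ‖β‖ < s ∨ S < ‖β‖) :
    LaurentApprox (fun z => (z - β)⁻¹) s S := by
  intro ε hε
  have hsum : ∀ (L : ℕ) (z : K),
      (∑ i ∈ Finset.range L, z ^ i * β ^ (L - 1 - i)) * (z - β) = z ^ L - β ^ L :=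
    fun L z => (Commute.all z β).geom_sum₂_mul L
  rcases hβ with hβ | hβ
  · have hq : ‖β‖ / s < 1 := (div_lt_one hs).2 hβ
    obtain ⟨L, hL⟩ := exists_pow_lt_of_lt_one (mul_pos hε hs) hq
    refine ⟨∑ i ∈ Finset.range L, X ^ i * C (β ^ (L - 1 - i)), L, fun z h1 h2 => ?_⟩
    have hlt : ‖β‖ < ‖z‖ := hβ.trans_le h1
    have hz : 0 < ‖z‖ := hs.trans_le h1
    have hz0 : z ≠ 0 := norm_pos_iff.1 hz
    have hzβ : z - β ≠ 0 := fun h => by rw [sub_eq_zero] at h; rw [h] at hlt; exact hlt.false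
    have he : (z - β)⁻¹ - (∑ i ∈ Finset.range L, X ^ i * C (β ^ (L - 1 - i))).eval z / z ^ L
        = (β / z) ^ L / (z - β) := by
      have h3 : (∑ i ∈ Finset.range L, X ^ i * C (β ^ (L - 1 - i))).eval z
          = (z ^ L - β ^ L) / (z - β) := by
        rw [eq_div_iff hzβ, ← hsum]
        simp [eval_finsetSum]
      rw [h3, div_pow]
      field_simp
      ring
    rw [he, norm_div, norm_pow, norm_div, norm_sub_eq_left hlt, div_lt_iff₀ hz]
    calc (‖β‖ / ‖z‖) ^ L ≤ (‖β‖ / s) ^ L := by gcongr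
      _ < ε * s := hL
      _ ≤ ε * ‖z‖ := by gcongr
  · by_cases hS : S < 0
    · exact ⟨0, 0, fun z h1 h2 => absurd (h2.trans_lt hS) (not_lt.2 (norm_nonneg _))⟩
    have hβ0 : 0 < ‖β‖ := (not_lt.1 hS).trans_lt hβ
    have hβ1 : β ≠ 0 := norm_pos_iff.1 hβ0
    have hq : S / ‖β‖ < 1 := (div_lt_one hβ0).2 hβ
    obtain ⟨L, hL⟩ := exists_pow_lt_of_lt_one (mul_pos hε hβ0) hq
    refine ⟨-(C (β ^ L)⁻¹ * ∑ i ∈ Finset.range L, X ^ i * C (β ^ (L - 1 - i))), 0,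
      fun z h1 h2 => ?_⟩
    have hlt : ‖z‖ < ‖β‖ := h2.trans_lt hβ
    have hzβ : z - β ≠ 0 := fun h => by rw [sub_eq_zero] at h; rw [h] at hlt; exact hlt.false
    have he : (z - β)⁻¹ -
        (-(C (β ^ L)⁻¹ * ∑ i ∈ Finset.range L, X ^ i * C (β ^ (L - 1 - i)))).eval z / z ^ 0
        = (z / β) ^ L / (z - β) := by
      have h3 : (∑ i ∈ Finset.range L, X ^ i * C (β ^ (L - 1 - i))).eval z
          = (z ^ L - β ^ L) / (z - β) := by
        rw [eq_div_iff hzβ, ← hsum]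
        simp [eval_finsetSum]
      rw [eval_neg, eval_mul, h3, eval_C, div_pow]
      field_simp
      ring
    rw [he, norm_div, norm_pow, norm_div, norm_sub_eq_right hlt, div_lt_iff₀ hβ0]
    calc (‖z‖ / ‖β‖) ^ L ≤ (S / ‖β‖) ^ L := by gcongr
      _ < ε * ‖β‖ := hL

lemma laurentApprox_inv_polynomial [IsAlgClosed K] {Q : K[X]} {s S : ℝ} (hs : 0 < s)
    (hQ : ∀ z, s ≤ ‖z‖ → ‖z‖ ≤ S → Q.eval z ≠ 0) :
    LaurentApprox (fun z => (Q.eval z)⁻¹) s S := by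
  by_cases hQ0 : Q = 0
  · exact fun ε _ => ⟨0, 0, fun z h1 h2 => absurd (by simp [hQ0]) (hQ z h1 h2)⟩
  have hprod : ∀ M : Multiset K, (∀ β ∈ M, ‖β‖ < s ∨ S < ‖β‖) →
      LaurentApprox (fun z => ((M.map fun β => z - β).prod)⁻¹) s S := by
    intro M
    induction M using Multiset.induction with
    | empty => intro _; simpa using laurentApprox_polynomial (1 : K[X]) s S
    | cons β M ih =>
      intro h
      simp only [Multiset.map_cons, Multiset.prod_cons, mul_inv]
      exact (laurentApprox_inv_sub hs (h β (Multiset.mem_cons_self _ _))).mul hs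
        (ih fun b hb => h b (Multiset.mem_cons_of_mem hb))
  have h1 := hprod Q.roots fun β hβ => by
    by_contra! hcon
    exact hQ β hcon.1 hcon.2 ((mem_roots hQ0).1 hβ)
  have h2 := (laurentApprox_polynomial (C Q.leadingCoeff⁻¹) s S).mul hs h1
  convert h2 using 2 with z
  conv_lhs => rw [(IsAlgClosed.splits Q).eq_prod_roots]
  rw [eval_mul, eval_C, eval_C, mul_inv, eval_multiset_prod, Multiset.map_map]
  simp

lemma laurentApprox_of_rational [IsAlgClosed K] {F : K → K} {s S : ℝ} (hs : 0 < s)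
    (h : ∀ ε : ℝ, 0 < ε → ∃ P Q : K[X], ∀ z, s ≤ ‖z‖ → ‖z‖ ≤ S →
      Q.eval z ≠ 0 ∧ ‖F z - P.eval z / Q.eval z‖ < ε) : LaurentApprox F s S := by
  intro ε hε
  obtain ⟨P, Q, hPQ⟩ := h ε hε
  obtain ⟨R, m, hR⟩ := (laurentApprox_polynomial P s S).mul hs
    (laurentApprox_inv_polynomial hs fun z h1 h2 => (hPQ z h1 h2).1) ε hε
  refine ⟨R, m, fun z h1 h2 => ?_⟩
  rw [← sub_add_sub_cancel (F z) (P.eval z / Q.eval z)]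
  exact norm_add_lt_of_lt (hPQ z h1 h2).2 (by simpa [div_eq_mul_inv] using hR z h1 h2)

/-- A function bounded by `1` on `s ≤ ‖z‖` has no polar part at infinity: the coefficients of the
positive powers of `z` are bounded by the Cauchy estimate on a very large circle. -/
lemma exists_polynomial_inv_approx [IsAlgClosed K] [CharZero K] {F : K → K} {s : ℝ} (hs : 0 < s)
    (hF : ∀ S, LaurentApprox F s S) (hb : ∀ z, s ≤ ‖z‖ → ‖F z‖ ≤ 1) {S ε : ℝ} (hS : s ≤ S)
    (hε : 0 < ε) : ∃ T : K[X], ∀ z, s ≤ ‖z‖ → ‖z‖ ≤ S → ‖F z - T.eval z⁻¹‖ < ε := by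
  obtain ⟨ρ, hρ⟩ := NormedField.exists_lt_norm K (max S (S / ε))
  have hSp : 0 < S := hs.trans_le hS
  have hρS : S < ‖ρ‖ := (le_max_left _ _).trans_lt hρ
  have hρε : S / ‖ρ‖ < ε := by
    have h1 := (le_max_right _ _).trans_lt hρ
    rw [div_lt_iff₀ hε] at h1
    rw [div_lt_iff₀ (hSp.trans hρS)]; linarith
  have hρ0 : 0 < ‖ρ‖ := hSp.trans hρS
  obtain ⟨P, m, hP⟩ := hF ‖ρ‖ (min ε 1) (by positivity)
  have hcoef : ∀ n, ‖P.coeff n‖ * ‖ρ‖ ^ n ≤ ‖ρ‖ ^ m := by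
    refine coeff_norm_mul_pow_le P fun x hx => ?_
    have hx1 : s ≤ ‖x‖ := by rw [hx]; exact hS.trans hρS.le
    have h1 : ‖P.eval x / x ^ m‖ ≤ 1 := by
      rw [← sub_sub_self (F x) (P.eval x / x ^ m)]
      exact norm_sub_le_of_le (hb x hx1) ((hP x hx1 hx.le).le.trans (min_le_right _ _))
    rw [norm_div, norm_pow, hx, div_le_one (by positivity)] at h1
    exact h1
  refine ⟨∑ n ∈ Finset.range (m + 1), C (P.coeff n) * X ^ (m - n), fun z h1 h2 => ?_⟩
  have hz : 0 < ‖z‖ := hs.trans_le h1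
  have hz0 : z ≠ 0 := norm_pos_iff.1 hz
  have hT : (∑ n ∈ Finset.range (m + 1), C (P.coeff n) * X ^ (m - n)).eval z⁻¹
      = (∑ n ∈ Finset.range (m + 1), P.coeff n * z ^ n) / z ^ m := by
    rw [eval_finsetSum, Finset.sum_div]
    refine Finset.sum_congr rfl fun n hn => ?_
    have hnm : n ≤ m := Nat.lt_succ_iff.1 (Finset.mem_range.1 hn)
    rw [eval_mul, eval_C, eval_pow, eval_X, inv_pow, mul_div_assoc]
    congr 1
    rw [eq_div_iff (pow_ne_zero _ hz0), ← Nat.sub_add_cancel hnm, Nat.add_sub_cancel, pow_add,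
      inv_mul_cancel_left₀ (pow_ne_zero _ hz0)]
  have hPz : P.eval z / z ^ m = (∑ n ∈ Finset.range (m + 1), C (P.coeff n) * X ^ (m - n)).eval z⁻¹
      + ∑ n ∈ Finset.range (P.natDegree + 1), P.coeff (m + 1 + n) * z ^ (n + 1) := by
    rw [hT, eval_eq_sum_range' (show P.natDegree < m + 1 + (P.natDegree + 1) by omega),
      Finset.sum_range_add, add_div]
    congr 1
    rw [Finset.sum_div]
    refine Finset.sum_congr rfl fun n _ => ?_
    rw [show m + 1 + n = (n + 1) + m by ring, pow_add, ← mul_assoc,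
      mul_div_cancel_right₀ _ (pow_ne_zero _ hz0)]
  have htail : ‖∑ n ∈ Finset.range (P.natDegree + 1), P.coeff (m + 1 + n) * z ^ (n + 1)‖
      ≤ S / ‖ρ‖ := by
    refine IsUltrametricDist.norm_sum_le_of_forall_le_of_nonneg (by positivity) fun n _ => ?_
    have h3 := hcoef (m + 1 + n)
    have h4 : ‖P.coeff (m + 1 + n)‖ * ‖ρ‖ ^ (n + 1) ≤ 1 := by
      rw [show m + 1 + n = m + (n + 1) by ring, pow_add ‖ρ‖, mul_left_comm] at h3
      rw [show m + 1 + n = m + (n + 1) by ring]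
      exact le_of_mul_le_mul_left (by simpa using h3) (pow_pos hρ0 m)
    have hq : ‖z‖ / ‖ρ‖ ≤ 1 := (div_le_one hρ0).2 (h2.trans hρS.le)
    rw [norm_mul, norm_pow]
    calc ‖P.coeff (m + 1 + n)‖ * ‖z‖ ^ (n + 1)
        = ‖P.coeff (m + 1 + n)‖ * ‖ρ‖ ^ (n + 1) * (‖z‖ / ‖ρ‖) ^ (n + 1) := by
          rw [div_pow]; field_simp
      _ ≤ 1 * (‖z‖ / ‖ρ‖) ^ (n + 1) := by gcongr
      _ ≤ ‖z‖ / ‖ρ‖ := by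
          rw [one_mul]; exact pow_le_of_le_one (by positivity) hq (Nat.succ_ne_zero n)
      _ ≤ S / ‖ρ‖ := by gcongr
  have h5 := (hP z h1 (h2.trans hρS.le)).trans_le (min_le_left ε 1)
  rw [hPz, ← sub_sub] at h5
  rw [← sub_add_cancel (F z - eval z⁻¹ _) (∑ n ∈ Finset.range (P.natDegree + 1),
    P.coeff (m + 1 + n) * z ^ (n + 1))]
  exact norm_add_lt_of_lt h5 (htail.trans_lt hρε)

/-- **Removable singularity at infinity.** A function on `‖z‖ > 1` which is bounded by `1` and a
uniform limit of rational functions on annuli is a power series in `1 / z` with integral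
coefficients. -/
theorem exists_powerSeries [IsAlgClosed K] [CharZero K] [CompleteSpace K] {F : K → K}
    (hF : ∀ s S, 1 < s → LaurentApprox F s S) (hb : ∀ z, 1 < ‖z‖ → ‖F z‖ ≤ 1) :
    ∃ a : ℕ → K, (∀ k, ‖a k‖ ≤ 1) ∧
      ∀ x, x ≠ 0 → ‖x‖ < 1 → HasSum (fun k => a k * x ^ k) (F x⁻¹) := by
  obtain ⟨w, hw⟩ := NormedField.exists_lt_norm K 3
  have hw0 : 0 < ‖w‖ := by linarith
  -- polynomials in `1 / z` approximating `F` on annuli that exhaust `‖z‖ > 1`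
  have hT : ∀ i : ℕ, ∃ T : K[X], ∀ z, 1 + 1 / ((i : ℝ) + 1) ≤ ‖z‖ → ‖z‖ ≤ ‖w‖ + i →
      ‖F z - T.eval z⁻¹‖ < 1 / ((i : ℝ) + 1) := by
    intro i
    have h1 : 0 < 1 / ((i : ℝ) + 1) := by positivity
    have h2 : 1 / ((i : ℝ) + 1) ≤ 1 := by
      rw [div_le_one (by positivity)]; linarith [Nat.cast_nonneg (α := ℝ) i]
    exact exists_polynomial_inv_approx (by linarith) (fun S => hF _ S (by linarith))
      (fun z hz => hb z (by linarith)) (by linarith [Nat.cast_nonneg (α := ℝ) i]) h1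
  choose T hT using hT
  have hinv : ∀ {m n : ℕ}, m ≤ n → 1 / ((n : ℝ) + 1) ≤ 1 / ((m : ℝ) + 1) :=
    fun h => Nat.one_div_le_one_div h
  have hdiff : ∀ x : K, ∀ n : ℕ, x ≠ 0 → 1 + 1 / ((n : ℝ) + 1) ≤ ‖x⁻¹‖ → ‖x⁻¹‖ ≤ ‖w‖ + n →
      ∀ i j, n ≤ i → n ≤ j → ∀ k,
      ‖(T i).coeff k - (T j).coeff k‖ * ‖x‖ ^ k ≤ 1 / ((n : ℝ) + 1) := by
    intro x n hx h1 h2 i j hi hj k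
    rw [← coeff_sub]
    refine coeff_norm_mul_pow_le (T i - T j) (fun y hy => ?_) k
    have hyx : ‖y⁻¹‖ = ‖x⁻¹‖ := by rw [norm_inv, norm_inv, hy]
    have hb' : ∀ l : ℕ, n ≤ l → ‖F y⁻¹ - (T l).eval y‖ ≤ 1 / ((n : ℝ) + 1) := fun l hl => by
      have h := hT l y⁻¹ (by rw [hyx]; linarith [hinv hl])
        (by rw [hyx]; have : (n : ℝ) ≤ l := by exact_mod_cast hl
            linarith)
      rw [inv_inv] at h
      exact h.le.trans (hinv hl)
    rw [eval_sub, ← sub_sub_sub_cancel_left _ _ (F y⁻¹)]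
    exact norm_sub_le_of_le (hb' j hj) (hb' i hi)
  have hwi : w⁻¹ ≠ 0 := inv_ne_zero (norm_pos_iff.1 hw0)
  have hcau : ∀ k, ∃ b, Tendsto (fun i => (T i).coeff k) atTop (𝓝 b) := by
    intro k
    refine cauchySeq_tendsto_of_complete
      (cauchySeq_of_le_tendsto_0 (fun n : ℕ => 1 / ((n : ℝ) + 1) * ‖w‖ ^ k) ?_ ?_)
    · intro i j n hi hj
      have h1 : 1 / ((n : ℝ) + 1) ≤ 1 := by
        rw [div_le_one (by positivity)]; linarith [Nat.cast_nonneg (α := ℝ) n]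
      have := hdiff w⁻¹ n hwi (by rw [inv_inv]; linarith)
        (by rw [inv_inv]; linarith [Nat.cast_nonneg (α := ℝ) n]) i j hi hj k
      rw [dist_eq_norm]
      rwa [norm_inv, inv_pow, ← div_eq_mul_inv, div_le_iff₀ (by positivity)] at this
    · have := (tendsto_one_div_add_atTop_nhds_zero_nat (𝕜 := ℝ)).mul_const (‖w‖ ^ k)
      rwa [zero_mul] at this
  choose a ha using hcau
  have hsum : ∀ x, x ≠ 0 → ‖x‖ < 1 → HasSum (fun k => a k * x ^ k) (F x⁻¹) := by
    intro x hx0 hx1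
    have hxp : 0 < ‖x‖ := norm_pos_iff.2 hx0
    have hxi : 1 < ‖x⁻¹‖ := by rw [norm_inv]; exact (one_lt_inv₀ hxp).2 hx1
    obtain ⟨n₁, hn₁⟩ := exists_nat_one_div_lt (sub_pos.2 hxi)
    obtain ⟨n₂, hn₂⟩ := exists_nat_ge ‖x⁻¹‖
    refine Metric.tendsto_atTop.2 fun ε hε => ?_
    obtain ⟨n₃, hn₃⟩ := exists_nat_one_div_lt hε
    set n := max n₁ (max n₂ n₃) with hn
    have h1 : 1 + 1 / ((n : ℝ) + 1) ≤ ‖x⁻¹‖ := by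
      have := hinv (le_max_left n₁ (max n₂ n₃)); linarith
    have h2 : ‖x⁻¹‖ ≤ ‖w‖ + n := by
      have : (n₂ : ℝ) ≤ n := by exact_mod_cast (le_max_left n₂ n₃).trans (le_max_right _ _)
      linarith
    have h3 : 1 / ((n : ℝ) + 1) < ε :=
      (hinv ((le_max_right n₂ n₃).trans (le_max_right _ _))).trans_lt hn₃
    have hcoef : ∀ k, ‖a k - (T n).coeff k‖ * ‖x‖ ^ k ≤ 1 / ((n : ℝ) + 1) := fun k => by
      refine le_of_tendsto (((ha k).sub_const ((T n).coeff k)).norm.mul_const _) ?_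
      filter_upwards [eventually_ge_atTop n] with i hi
      exact hdiff x n hx0 h1 h2 i n hi le_rfl k
    refine ⟨Finset.range ((T n).natDegree + 1), fun s hs => ?_⟩
    have hTs : (T n).eval x = ∑ k ∈ s, (T n).coeff k * x ^ k := by
      rw [eval_eq_sum_range]
      refine Finset.sum_subset hs fun k _ hk => ?_
      rw [coeff_eq_zero_of_natDegree_lt (by simpa using hk), zero_mul]
    have h4 := hT n x⁻¹ h1 h2
    rw [inv_inv] at h4
    rw [dist_eq_norm, ← sub_add_sub_cancel _ ((T n).eval x)]
    refine norm_add_lt_of_lt ?_ (by rw [norm_sub_rev]; exact h4.trans h3)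
    rw [hTs, ← Finset.sum_sub_distrib]
    refine (IsUltrametricDist.norm_sum_le_of_forall_le_of_nonneg (by positivity)
      fun k _ => ?_).trans_lt h3
    rw [← sub_mul, norm_mul, norm_pow]
    exact hcoef k
  refine ⟨a, fun k => ?_, hsum⟩
  by_contra! hk
  have hcont : Tendsto (fun r : ℝ => ‖a k‖ * r ^ k) (𝓝 1) (𝓝 (‖a k‖ * 1 ^ k)) :=
    (Continuous.tendsto (by fun_prop) 1)
  rw [one_pow, mul_one] at hcont
  obtain ⟨δ, hδ, hball⟩ := Metric.eventually_nhds_iff.1 (hcont.eventually_const_lt hk)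
  obtain ⟨x, hx0, hx1, hx2⟩ :=
    exists_norm_between (K := K) (a := max (1 / 2) (1 - δ)) (b := 1) (by positivity)
      (max_lt (by norm_num) (by linarith))
  have hlt := hball (y := ‖x‖) (by
    rw [Real.dist_eq, abs_sub_lt_iff]
    constructor <;> linarith [(le_max_right (1 / 2) (1 - δ)).trans_lt hx1])
  obtain ⟨y, hy, hy2⟩ := exists_generic_point (Finset.univ : Finset Unit) (fun _ => a)
    (fun _ x => F x⁻¹) (fun _ => k) x fun _ _ y hy =>
      hsum y (norm_pos_iff.1 (by rw [hy]; exact norm_pos_iff.2 hx0)) (by rwa [hy])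
  have h1 := (hlt.trans_le (hy2 () (Finset.mem_univ _)))
  refine absurd (hb y⁻¹ ?_) (not_le.2 h1)
  rw [norm_inv, hy]
  exact (one_lt_inv₀ (norm_pos_iff.2 hx0)).2 hx2

end LaurentExpansion

/-! ### The Böttcher equation -/

section Core

variable {K : Type*} [NontriviallyNormedField K]

lemma pow_sub_one_eq_prod_roots [IsAlgClosed K] [CharZero K] {d : ℕ} (hd : 0 < d) (y : K) :
    (1 + y) ^ d - 1 = ∏ w ∈ nthRootsFinset d (1 : K), (1 - w + y) := by
  have : NeZero (d : K) := ⟨by exact_mod_cast hd.ne'⟩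
  obtain ⟨ζ, hζ⟩ := HasEnoughRootsOfUnity.exists_primitiveRoot K d
  have h := hζ.pow_sub_pow_eq_prod_sub_mul (1 + y) 1 hd
  rw [one_pow] at h
  rw [h]
  exact Finset.prod_congr rfl fun w _ => by ring

variable [IsUltrametricDist K]

lemma hasSum_norm_lt {a : ℕ → K} {s : K} {c : ℝ} (hc : 0 < c) (h : HasSum a s)
    (ha : ∀ k, ‖a k‖ < c) : ‖s‖ < c := by
  have h0 : Tendsto (fun k => ‖a k‖) atTop (𝓝 0) :=
    tendsto_zero_iff_norm_tendsto_zero.1 h.summable.tendsto_atTop_zero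
  obtain ⟨N, hN⟩ := eventually_atTop.1 (h0.eventually_lt_const (half_pos hc))
  have h1 : HasSum (fun k => a (k + N)) (s - ∑ k ∈ Finset.range N, a k) :=
    (hasSum_nat_add_iff' N).2 h
  have h2 : ‖s - ∑ k ∈ Finset.range N, a k‖ ≤ c / 2 :=
    hasSum_norm_le h1 fun k => (hN (k + N) (Nat.le_add_left _ _)).le
  have h3 : ∀ M, ‖∑ k ∈ Finset.range M, a k‖ < c := by
    intro M
    induction M with
    | zero => rw [Finset.sum_range_zero, norm_zero]; exact hc
    | succ M ih => rw [Finset.sum_range_succ]; exact norm_add_lt_of_lt ih (ha M)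
  have h4 := norm_add_lt_of_lt (h2.trans_lt (half_lt_self hc)) (h3 N)
  rwa [sub_add_cancel] at h4

/-- The size `E r ^ (d ^ (n + 1)) / D ^ (n + 1)` at `‖x‖ = r` of the monomial
`(e / d ^ (n + 1)) x ^ (d ^ (n + 1))`, where `E = ‖e‖` and `D = ‖d‖`. -/
noncomputable def levelTerm (E D : ℝ) (d n : ℕ) (r : ℝ) : ℝ := E * r ^ d ^ (n + 1) / D ^ (n + 1)

lemma exists_pow_le {d : ℕ} (hd : 2 ≤ d) {r D T : ℝ} (hr : 0 ≤ r) (hr1 : r < 1) (hD : 0 < D)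
    (hT : 0 < T) : ∃ n : ℕ, r ^ d ^ n ≤ D ^ n * T := by
  have hd' : (1 : ℝ) < d := by exact_mod_cast hd
  obtain ⟨s, hs⟩ := pow_unbounded_of_one_lt D⁻¹ hd'
  have ht := (tendsto_pow_const_mul_const_pow_of_abs_lt_one s (by rwa [abs_of_nonneg hr])).comp
    (tendsto_pow_atTop_atTop_of_one_lt (show 1 < d from hd))
  obtain ⟨n, hn⟩ := (ht.eventually_lt_const hT).exists
  refine ⟨n, ?_⟩
  simp only [Function.comp_apply, Nat.cast_pow] at hn
  have h1 : D⁻¹ ^ n ≤ ((d : ℝ) ^ n) ^ s := by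
    rw [← pow_mul, mul_comm n s, pow_mul]
    exact pow_le_pow_left₀ (by positivity) hs.le n
  have h2 : D⁻¹ ^ n * r ^ d ^ n ≤ T :=
    (mul_le_mul_of_nonneg_right h1 (by positivity)).trans hn.le
  rwa [inv_pow, inv_mul_le_iff₀ (by positivity)] at h2

section levelTerm

variable {E D r : ℝ} {d : ℕ}

lemma levelTerm_pos (hE : 0 < E) (hD : 0 < D) (hr : 0 < r) (n : ℕ) :
    0 < levelTerm E D d n r := by
  unfold levelTerm; positivity

lemma levelTerm_zero (hD : 0 < D) : D * levelTerm E D d 0 r = E * r ^ d := by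
  unfold levelTerm; simp only [zero_add, pow_one]; field_simp

lemma levelTerm_pow (hD : 0 < D) (n : ℕ) :
    levelTerm E D d n (r ^ d) = D * levelTerm E D d (n + 1) r := by
  unfold levelTerm
  rw [← pow_mul, ← pow_succ' d, pow_succ D (n + 1)]
  field_simp

lemma levelTerm_succ (hD : 0 < D) (hd : 1 ≤ d) (n : ℕ) :
    levelTerm E D d (n + 1) r = levelTerm E D d n r * (r ^ (d ^ (n + 1) * (d - 1)) / D) := by
  unfold levelTerm
  have : d ^ (n + 1 + 1) = d ^ (n + 1) + d ^ (n + 1) * (d - 1) := by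
    obtain ⟨m, rfl⟩ : ∃ m, d = m + 1 := ⟨d - 1, by omega⟩
    rw [Nat.add_sub_cancel]; ring
  rw [this, pow_add r, pow_succ D (n + 1)]
  field_simp

lemma levelTerm_le_of_ge (hE : 0 < E) (hD : 0 < D) (hd : 1 ≤ d) (hr : 0 < r) (hr1 : r < 1)
    {N : ℕ} (h : r ^ (d ^ (N + 1) * (d - 1)) ≤ D) {n : ℕ} (hn : N ≤ n) :
    levelTerm E D d n r ≤ levelTerm E D d N r := by
  induction n, hn using Nat.le_induction with
  | base => exact le_rfl
  | succ n hn ih =>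
    refine le_trans ?_ ih
    rw [levelTerm_succ hD hd]
    refine mul_le_of_le_one_right (levelTerm_pos hE hD hr n).le ((div_le_one hD).2 (le_trans ?_ h))
    exact pow_le_pow_of_le_one hr.le hr1.le
      (Nat.mul_le_mul_right _ (Nat.pow_le_pow_right hd (by omega)))

lemma levelTerm_lt_succ (hE : 0 < E) (hD : 0 < D) (hd : 1 ≤ d) (hr : 0 < r)
    {n : ℕ} (h : D < r ^ (d ^ (n + 1) * (d - 1))) :
    levelTerm E D d n r < levelTerm E D d (n + 1) r := by
  rw [levelTerm_succ hD hd]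
  exact lt_mul_of_one_lt_right (levelTerm_pos hE hD hr n) ((one_lt_div hD).2 h)

lemma levelTerm_le_of_le (hE : 0 < E) (hD : 0 < D) (hd : 1 ≤ d) (hr : 0 < r) (hr1 : r < 1)
    {N : ℕ} (h : N = 0 ∨ D < r ^ (d ^ N * (d - 1))) {n : ℕ} (hn : n ≤ N) :
    levelTerm E D d n r ≤ levelTerm E D d N r := by
  induction N with
  | zero => rw [Nat.le_zero.1 hn]
  | succ N ih =>
    have h' := h.resolve_left (Nat.succ_ne_zero N)
    rcases Nat.lt_or_ge n (N + 1) with hlt | hge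
    · refine (ih (Or.inr (h'.trans_le ?_)) (by omega)).trans
        (levelTerm_lt_succ hE hD hd hr h').le
      exact pow_le_pow_of_le_one hr.le hr1.le
        (Nat.mul_le_mul_right _ (Nat.pow_le_pow_right hd (by omega)))
    · rw [le_antisymm hn hge]

lemma levelTerm_le (hE : 0 < E) (hD : 0 < D) (hd : 1 ≤ d) (hr : 0 < r) (hr1 : r < 1)
    {N : ℕ} (hlo : N = 0 ∨ D < r ^ (d ^ N * (d - 1))) (hhi : r ^ (d ^ (N + 1) * (d - 1)) ≤ D)
    (n : ℕ) : levelTerm E D d n r ≤ levelTerm E D d N r := by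
  rcases le_total n N with h | h
  · exact levelTerm_le_of_le hE hD hd hr hr1 hlo h
  · exact levelTerm_le_of_ge hE hD hd hr hr1 hhi h

end levelTerm

/-- `A(x) = ∑ a k x ^ (k + 1)` is a solution, with integral coefficients, of the functional
equation `(1 + A(x)) ^ d - 1 = e x ^ d + (1 - c x ^ d) A(x ^ d / (1 - c x ^ d))` on the punctured
open unit disk. In the coordinate `x = 1 / z` this says that `z ↦ z (1 + A(1 / z))` semiconjugates
`z ^ d - c` to `z ^ d - (c + e)`. -/
structure IsBottcherSolution (d : ℕ) (c e : K) (a : ℕ → K) (A : K → K) : Prop where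
  norm_c_le : ‖c‖ ≤ 1
  norm_coeff_le : ∀ k, ‖a k‖ ≤ 1
  hasSum : ∀ x, x ≠ 0 → ‖x‖ < 1 → HasSum (fun k => a k * x ^ (k + 1)) (A x)
  eqn : ∀ x, x ≠ 0 → ‖x‖ < 1 →
    (1 + A x) ^ d - 1 = e * x ^ d + (1 - c * x ^ d) * A (x ^ d / (1 - c * x ^ d))

/-- `κ` is the least distance from `1` to another `d`-th root of unity. -/
structure IsRootGap (K : Type*) [NontriviallyNormedField K] (d : ℕ) (κ : ℝ) : Prop where
  pos : 0 < κ
  le : ∀ w : K, w ^ d = 1 → w ≠ 1 → κ ≤ ‖1 - w‖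
  exists_eq : ∃ w : K, w ^ d = 1 ∧ w ≠ 1 ∧ ‖1 - w‖ = κ

/-- Within the root gap, `y ↦ (1 + y) ^ d - 1` scales norms by `‖d‖`. -/
lemma norm_pow_sub_one [IsAlgClosed K] [CharZero K] {d : ℕ} (hd : 0 < d) {κ : ℝ}
    (hκ : IsRootGap K d κ) {y : K} (hy : ‖y‖ < κ) :
    ‖(1 + y) ^ d - 1‖ = ‖(d : K)‖ * ‖y‖ := by
  classical
  have h1 : (1 : K) ∈ nthRootsFinset d (1 : K) := by simp [mem_nthRootsFinset hd]
  rw [pow_sub_one_eq_prod_roots hd, norm_prod, ← Finset.mul_prod_erase _ _ h1, sub_self, zero_add,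
    mul_comm, ← prod_norm_one_sub hd]
  congr 1
  refine Finset.prod_congr rfl fun w hw => norm_add_eq_left (hy.trans_le (hκ.le w ?_ ?_))
  · exact (mem_nthRootsFinset hd _).1 (Finset.mem_of_mem_erase hw)
  · exact Finset.ne_of_mem_erase hw

namespace IsBottcherSolution

variable {d : ℕ} {c e : K} {a : ℕ → K} {A : K → K} {κ : ℝ}

lemma norm_one_sub (h : IsBottcherSolution d c e a A) (hd : 0 < d) {x : K} (hx : ‖x‖ < 1) :
    ‖1 - c * x ^ d‖ = 1 := by
  rw [norm_sub_eq_left, norm_one]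
  rw [norm_one, norm_mul, norm_pow]
  exact (mul_le_of_le_one_left (by positivity) h.norm_c_le).trans_lt
    (pow_lt_one₀ (norm_nonneg _) hx hd.ne')

lemma norm_image (h : IsBottcherSolution d c e a A) (hd : 0 < d) {x : K} (hx : ‖x‖ < 1) :
    ‖x ^ d / (1 - c * x ^ d)‖ = ‖x‖ ^ d := by
  rw [norm_div, h.norm_one_sub hd hx, div_one, norm_pow]

lemma image_ne_zero (h : IsBottcherSolution d c e a A) (hd : 0 < d) {x : K} (hx0 : x ≠ 0)
    (hx : ‖x‖ < 1) : x ^ d / (1 - c * x ^ d) ≠ 0 := by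
  rw [← norm_pos_iff, h.norm_image hd hx]
  exact pow_pos (norm_pos_iff.2 hx0) d

lemma norm_image_lt (h : IsBottcherSolution d c e a A) (hd : 0 < d) {x : K}
    (hx : ‖x‖ < 1) : ‖x ^ d / (1 - c * x ^ d)‖ < 1 := by
  rw [h.norm_image hd hx]
  exact pow_lt_one₀ (norm_nonneg _) hx hd.ne'

/-- On `‖x‖ = ‖x₀‖`, both sides of the functional equation are bounded by `B` if `e x ^ d` is and
if the terms of `A` on the image circle are. -/
lemma rhs_bound (h : IsBottcherSolution d c e a A) (hd : 0 < d) {x₀ : K} (hx₀ : x₀ ≠ 0)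
    (hx₁ : ‖x₀‖ < 1) {B : ℝ} (he : ‖e‖ * ‖x₀‖ ^ d ≤ B)
    (hB : ∀ k, ‖a k‖ * (‖x₀‖ ^ d) ^ (k + 1) ≤ B) (x : K) (hx : ‖x‖ = ‖x₀‖) :
    ‖(1 + A x) ^ d - 1‖ ≤ B := by
  have hx0 : x ≠ 0 := norm_pos_iff.1 (hx ▸ norm_pos_iff.2 hx₀)
  have hx1 : ‖x‖ < 1 := hx ▸ hx₁
  rw [h.eqn x hx0 hx1]
  refine norm_add_le_of_le (by rwa [norm_mul, norm_pow, hx]) ?_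
  rw [norm_mul, h.norm_one_sub hd hx1, one_mul]
  refine hasSum_norm_le (h.hasSum _ (h.image_ne_zero hd hx0 hx1) (h.norm_image_lt hd hx1))
    fun k => ?_
  rw [norm_mul, norm_pow, h.norm_image hd hx1, hx]
  exact hB k

variable [IsAlgClosed K] [CharZero K]

/-- If `(1 + A) ^ d - 1` is bounded by `B` on a circle, then each term `y` of `A` on that circle
satisfies `‖d‖ y max(y, κ) / κ ≤ B`. At a generic point of the circle the factors `A`, `A + 1 - ζ`
and `A + 1 - w` of `(1 + A) ^ d - 1` are at least `y`, `max(y, κ)` and `‖1 - w‖`. -/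
lemma term_bound (h : IsBottcherSolution d c e a A) (hd : 0 < d) (hκ : IsRootGap K d κ)
    {x₀ : K} (hx₀ : x₀ ≠ 0) (hx₁ : ‖x₀‖ < 1) {B : ℝ}
    (hB : ∀ x, ‖x‖ = ‖x₀‖ → ‖(1 + A x) ^ d - 1‖ ≤ B) (k : ℕ) :
    ‖(d : K)‖ * (‖a k‖ * ‖x₀‖ ^ (k + 1) * max (‖a k‖ * ‖x₀‖ ^ (k + 1)) κ) ≤ B * κ := by
  classical
  set y := ‖a k‖ * ‖x₀‖ ^ (k + 1) with hy
  obtain ⟨ζ, hζ, hζ1, hζκ⟩ := hκ.exists_eq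
  let b : K → ℕ → K := fun w n => Nat.casesOn n (1 - w) a
  let n : K → ℕ := fun w => if w = 1 then k + 1 else if w = ζ then (if κ ≤ y then k + 1 else 0)
    else 0
  obtain ⟨x, hx, hgen⟩ := exists_generic_point (nthRootsFinset d (1 : K)) b
    (fun w x => 1 - w + A x) n x₀ (by
      intro w _ x hx
      have hs := h.hasSum x (norm_pos_iff.1 (hx ▸ norm_pos_iff.2 hx₀)) (hx ▸ hx₁)
      rw [← hasSum_nat_add_iff' 1]
      simpa [b] using hs)
  have m1 : (1 : K) ∈ nthRootsFinset d (1 : K) := by simp [mem_nthRootsFinset hd]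
  have mζ : ζ ∈ (nthRootsFinset d (1 : K)).erase 1 :=
    Finset.mem_erase.2 ⟨hζ1, (mem_nthRootsFinset hd _).2 hζ⟩
  have g1 : y ≤ ‖1 - 1 + A x‖ := by simpa [n, b, hy] using hgen 1 m1
  have gζ : max y κ ≤ ‖1 - ζ + A x‖ := by
    have := hgen ζ (Finset.mem_of_mem_erase mζ)
    by_cases hyκ : κ ≤ y
    · have hn : n ζ = k + 1 := by simp only [n, if_neg hζ1, if_pos hyκ, if_true]
      rw [hn] at this
      rwa [max_eq_left hyκ]
    · have hn : n ζ = 0 := by simp only [n, if_neg hζ1, if_neg hyκ, if_true]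
      rw [hn, pow_zero, mul_one] at this
      rw [max_eq_right (not_le.1 hyκ).le, ← hζκ]
      exact this
  have gw : ∏ w ∈ ((nthRootsFinset d (1 : K)).erase 1).erase ζ, ‖1 - w‖
      ≤ ∏ w ∈ ((nthRootsFinset d (1 : K)).erase 1).erase ζ, ‖1 - w + A x‖ := by
    refine Finset.prod_le_prod (fun _ _ => norm_nonneg _) fun w hw => ?_
    have hwζ := Finset.ne_of_mem_erase hw
    have hw1 := Finset.ne_of_mem_erase (Finset.mem_of_mem_erase hw)
    simpa [n, b, hw1, hwζ] using
      hgen w (Finset.mem_of_mem_erase (Finset.mem_of_mem_erase hw))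
  have hD := prod_norm_one_sub (K := K) hd
  rw [← Finset.mul_prod_erase _ _ mζ, hζκ] at hD
  have hBx := hB x hx
  rw [pow_sub_one_eq_prod_roots hd, norm_prod, ← Finset.mul_prod_erase _ _ m1,
    ← Finset.mul_prod_erase _ _ mζ] at hBx
  set G := ∏ w ∈ ((nthRootsFinset d (1 : K)).erase 1).erase ζ, ‖1 - w‖
  have hG : 0 ≤ G := Finset.prod_nonneg fun _ _ => norm_nonneg _
  have hy0 : 0 ≤ y := by positivity
  have hm : 0 ≤ max y κ := hy0.trans (le_max_left _ _)
  rw [← hD]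
  calc κ * G * (y * max y κ) = (y * (max y κ * G)) * κ := by ring
    _ ≤ B * κ := by
      refine mul_le_mul_of_nonneg_right (le_trans ?_ hBx) hκ.pos.le
      gcongr

/-- `upper_bound` for radii whose `n`-th iterate under `r ↦ r ^ d` is so small that the trivial
bound `‖A x‖ ≤ ‖x‖` suffices; the functional equation carries the bound from `r ^ d` to `r`. -/
lemma upper_bound_aux (h : IsBottcherSolution d c e a A) (hd : 0 < d) (hκ : IsRootGap K d κ)
    (hd1 : ‖(d : K)‖ < 1) (n : ℕ) : ∀ (x₀ : K) (T : ℝ), x₀ ≠ 0 → ‖x₀‖ < 1 → 0 < T → T < κ →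
      ‖x₀‖ ^ d ^ n ≤ ‖(d : K)‖ ^ n * T → (∀ j, levelTerm ‖e‖ ‖(d : K)‖ d j ‖x₀‖ ≤ T) →
      ∀ k, ‖a k‖ * ‖x₀‖ ^ (k + 1) ≤ T := by
  have hD : 0 < ‖(d : K)‖ := norm_pos_iff.2 (by exact_mod_cast hd.ne')
  induction n with
  | zero =>
    intro x₀ T hx0 hx1 hT hTκ hbase _ k
    simp only [pow_zero, pow_one, one_mul] at hbase
    refine le_trans (le_trans (mul_le_of_le_one_left (by positivity) (h.norm_coeff_le k)) ?_) hbase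
    exact pow_le_of_le_one (norm_nonneg _) hx1.le (Nat.succ_ne_zero k)
  | succ n ih =>
    intro x₀ T hx0 hx1 hT hTκ hbase hlev k
    have hDT : ‖(d : K)‖ * T < κ := (mul_le_of_le_one_left hT.le hd1.le).trans_lt hTκ
    have hstep := ih (x₀ ^ d) (‖(d : K)‖ * T) (pow_ne_zero _ hx0)
      (by rw [norm_pow]; exact pow_lt_one₀ (norm_nonneg _) hx1 hd.ne') (by positivity) hDT
      (by rw [norm_pow, ← pow_mul, ← pow_succ' d, ← mul_assoc, ← pow_succ]; exact hbase)
      (fun j => by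
        rw [norm_pow, levelTerm_pow hD]
        exact mul_le_mul_of_nonneg_left (hlev _) hD.le)
    have hB := h.term_bound hd hκ hx0 hx1 (B := ‖(d : K)‖ * T) (h.rhs_bound hd hx0 hx1
      (by rw [← levelTerm_zero hD]; exact mul_le_mul_of_nonneg_left (hlev 0) hD.le)
      (fun k => by have := hstep k; rwa [norm_pow] at this)) k
    set y := ‖a k‖ * ‖x₀‖ ^ (k + 1)
    have hy0 : 0 ≤ y := by positivity
    have h2 := le_of_mul_le_mul_left (hB.trans_eq (mul_assoc _ _ _)) hD
    have h3 : y * κ ≤ T * κ :=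
      (mul_le_mul_of_nonneg_left (le_max_right y κ) hy0).trans h2
    exact le_of_mul_le_mul_right h3 hκ.pos

/-- As long as all level terms are below the root gap, they bound `A`. -/
lemma upper_bound (h : IsBottcherSolution d c e a A) (hd : 2 ≤ d) (hκ : IsRootGap K d κ)
    (hd1 : ‖(d : K)‖ < 1) {x₀ : K} {T : ℝ} (hx0 : x₀ ≠ 0) (hx1 : ‖x₀‖ < 1) (hT : 0 < T)
    (hTκ : T < κ) (hlev : ∀ j, levelTerm ‖e‖ ‖(d : K)‖ d j ‖x₀‖ ≤ T) (k : ℕ) :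
    ‖a k‖ * ‖x₀‖ ^ (k + 1) ≤ T := by
  have hD : 0 < ‖(d : K)‖ := norm_pos_iff.2 (by exact_mod_cast (by omega : d ≠ 0))
  obtain ⟨n, hn⟩ := exists_pow_le hd (norm_nonneg x₀) hx1 hD hT
  exact h.upper_bound_aux (by omega) hκ hd1 n x₀ T hx0 hx1 hT hTκ hn hlev k

/-- Where the `N`-th level term strictly dominates and is below the root gap, it gives the exact
size of `A`. -/
lemma norm_eq_levelTerm (h : IsBottcherSolution d c e a A) (hd : 2 ≤ d) (hκ : IsRootGap K d κ)
    (hd1 : ‖(d : K)‖ < 1) (he : e ≠ 0) (N : ℕ) : ∀ x : K, x ≠ 0 → ‖x‖ < 1 →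
      levelTerm ‖e‖ ‖(d : K)‖ d N ‖x‖ < κ →
      (N = 0 ∨ ‖(d : K)‖ < ‖x‖ ^ (d ^ N * (d - 1))) →
      ‖x‖ ^ (d ^ (N + 1) * (d - 1)) < ‖(d : K)‖ →
      ‖A x‖ = levelTerm ‖e‖ ‖(d : K)‖ d N ‖x‖ := by
  have hD : 0 < ‖(d : K)‖ := norm_pos_iff.2 (by exact_mod_cast (by omega : d ≠ 0))
  have hE : 0 < ‖e‖ := norm_pos_iff.2 he
  have hd0 : 0 < d := by omega
  have hfin : ∀ N (x : K), x ≠ 0 → ‖x‖ < 1 → levelTerm ‖e‖ ‖(d : K)‖ d N ‖x‖ < κ →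
      (N = 0 ∨ ‖(d : K)‖ < ‖x‖ ^ (d ^ N * (d - 1))) →
      ‖x‖ ^ (d ^ (N + 1) * (d - 1)) < ‖(d : K)‖ →
      ‖(1 + A x) ^ d - 1‖ = ‖(d : K)‖ * levelTerm ‖e‖ ‖(d : K)‖ d N ‖x‖ →
      ‖A x‖ = levelTerm ‖e‖ ‖(d : K)‖ d N ‖x‖ := by
    intro N x hx0 hx1 hlt hlo hhi heq
    have hx := norm_pos_iff.2 hx0
    have hup := h.upper_bound hd hκ hd1 hx0 hx1 (levelTerm_pos hE hD hx N) hlt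
      (levelTerm_le hE hD hd0 hx hx1 hlo hhi.le)
    have hAx := hasSum_norm_le (h.hasSum x hx0 hx1) fun k => by
      rw [norm_mul, norm_pow]; exact hup k
    rw [norm_pow_sub_one hd0 hκ (hAx.trans_lt hlt)] at heq
    exact mul_left_cancel₀ hD.ne' heq
  induction N with
  | zero =>
    intro x hx0 hx1 hlt hlo hhi
    have hx := norm_pos_iff.2 hx0
    refine hfin 0 x hx0 hx1 hlt hlo hhi ?_
    have hx1' := h.norm_image_lt hd0 hx1
    have hx0' := h.image_ne_zero hd0 hx0 hx1
    have hnx := h.norm_image hd0 hx1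
    set x' := x ^ d / (1 - c * x ^ d)
    have hlev : levelTerm ‖e‖ ‖(d : K)‖ d 0 ‖x'‖
        < ‖(d : K)‖ * levelTerm ‖e‖ ‖(d : K)‖ d 0 ‖x‖ := by
      rw [hnx, levelTerm_pow hD, levelTerm_succ hD hd0]
      refine mul_lt_mul_of_pos_left ?_ hD
      exact mul_lt_of_lt_one_right (levelTerm_pos hE hD hx 0) ((div_lt_one hD).2 hhi)
    have hlevκ : levelTerm ‖e‖ ‖(d : K)‖ d 0 ‖x'‖ < κ :=
      hlev.trans ((mul_le_of_le_one_left (levelTerm_pos hE hD hx 0).le hd1.le).trans_lt hlt)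
    have hhi' : ‖x'‖ ^ (d ^ (0 + 1) * (d - 1)) ≤ ‖(d : K)‖ := by
      refine le_trans (pow_le_pow_left₀ (norm_nonneg _) ?_ _) hhi.le
      rw [hnx]; exact pow_le_of_le_one hx.le hx1.le hd0.ne'
    have hup := h.upper_bound hd hκ hd1 hx0' hx1'
      (levelTerm_pos hE hD (norm_pos_iff.2 hx0') 0) hlevκ
      (levelTerm_le hE hD hd0 (norm_pos_iff.2 hx0') hx1' (Or.inl rfl) hhi')
    have hAx := hasSum_norm_le (h.hasSum x' hx0' hx1') fun k => by
      rw [norm_mul, norm_pow]; exact hup k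
    have hex : ‖e * x ^ d‖ = ‖(d : K)‖ * levelTerm ‖e‖ ‖(d : K)‖ d 0 ‖x‖ := by
      rw [levelTerm_zero hD, norm_mul, norm_pow]
    rw [h.eqn x hx0 hx1, norm_add_eq_left, hex]
    rw [hex, norm_mul, h.norm_one_sub hd0 hx1, one_mul]
    exact hAx.trans_lt hlev
  | succ N ih =>
    intro x hx0 hx1 hlt hlo hhi
    have hx := norm_pos_iff.2 hx0
    refine hfin (N + 1) x hx0 hx1 hlt hlo hhi ?_
    have hlo' := hlo.resolve_left (Nat.succ_ne_zero N)
    have hx1' := h.norm_image_lt hd0 hx1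
    have hx0' := h.image_ne_zero hd0 hx0 hx1
    have hnx := h.norm_image hd0 hx1
    have heqn := h.eqn x hx0 hx1
    set x' := x ^ d / (1 - c * x ^ d)
    have hpow : ∀ n, ‖x'‖ ^ (d ^ n * (d - 1)) = ‖x‖ ^ (d ^ (n + 1) * (d - 1)) := by
      intro n; rw [hnx, ← pow_mul, ← mul_assoc, ← pow_succ']
    have hlev : levelTerm ‖e‖ ‖(d : K)‖ d N ‖x'‖
        = ‖(d : K)‖ * levelTerm ‖e‖ ‖(d : K)‖ d (N + 1) ‖x‖ := by
      rw [hnx, levelTerm_pow hD]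
    have hAx := ih x' hx0' hx1'
      (hlev ▸ (mul_le_of_le_one_left (levelTerm_pos hE hD hx _).le hd1.le).trans_lt hlt)
      (Or.inr (by rw [hpow]; exact hlo')) (by rw [hpow]; exact hhi)
    have hle : levelTerm ‖e‖ ‖(d : K)‖ d 0 ‖x‖ < levelTerm ‖e‖ ‖(d : K)‖ d (N + 1) ‖x‖ := by
      refine lt_of_le_of_lt (levelTerm_le_of_le hE hD hd0 hx hx1 (Or.inr (hlo'.trans_le ?_))
        (Nat.zero_le N)) (levelTerm_lt_succ hE hD hd0 hx hlo')
      exact pow_le_pow_of_le_one hx.le hx1.le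
        (Nat.mul_le_mul_right _ (Nat.pow_le_pow_right hd0 (by omega)))
    have hA' : ‖(1 - c * x ^ d) * A x'‖
        = ‖(d : K)‖ * levelTerm ‖e‖ ‖(d : K)‖ d (N + 1) ‖x‖ := by
      rw [norm_mul, h.norm_one_sub hd0 hx1, one_mul, hAx, hlev]
    rw [heqn, add_comm, norm_add_eq_left, hA']
    rw [hA', norm_mul, norm_pow, ← levelTerm_zero hD]
    exact mul_lt_mul_of_pos_left hle hD

/-- The `N`-th level term cannot cross the root gap in the range where it dominates: it would
force a term of `A` of degree at least `d ^ (N + 1)`, while beyond the root gap the functional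
equation only allows `A` to grow more slowly than that. -/
theorem false_of_crossing (h : IsBottcherSolution d c e a A) (hd : 2 ≤ d) (hκ : IsRootGap K d κ)
    (hd1 : ‖(d : K)‖ < 1) (he : e ≠ 0) (N : ℕ) {X : ℝ} (hX : ‖e‖ * X = κ * ‖(d : K)‖ ^ (N + 1))
    (hlo : N = 0 ∨ ‖(d : K)‖ ^ d < X ^ (d - 1)) (hhi : X ^ (d - 1) < ‖(d : K)‖) : False := by
  have hD : 0 < ‖(d : K)‖ := norm_pos_iff.2 (by exact_mod_cast (by omega : d ≠ 0))
  have hE : 0 < ‖e‖ := norm_pos_iff.2 he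
  have hd0 : 0 < d := by omega
  set D := ‖(d : K)‖ with hDdef
  set E := ‖e‖ with hEdef
  set m := d ^ (N + 1) with hm
  have hm0 : m ≠ 0 := by positivity
  have hXpos : 0 < X := by
    have : 0 < E * X := hX ▸ mul_pos hκ.pos (by positivity)
    exact (pos_iff_pos_of_mul_pos this).1 hE
  -- the radius at which the `N`-th level term equals `κ`
  obtain ⟨ρ, hρ0, hρX⟩ : ∃ ρ : ℝ, 0 < ρ ∧ ρ ^ m = X :=
    ⟨X ^ (m⁻¹ : ℝ), Real.rpow_pos_of_pos hXpos _, Real.rpow_inv_natCast_pow hXpos.le hm0⟩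
  have hρlev : levelTerm E D d N ρ = κ := by
    unfold levelTerm; rw [hρX, hX, mul_div_assoc, div_self (by positivity), mul_one]
  have hρhi : ρ ^ (m * (d - 1)) < D := by rwa [pow_mul, hρX]
  have hρ1 : ρ < 1 := by
    by_contra! hge
    exact absurd (hρhi.trans hd1) (not_lt.2 (one_le_pow₀ hge))
  have hρlo : N = 0 ∨ D < ρ ^ (d ^ N * (d - 1)) := by
    refine hlo.imp id fun hlo => ?_
    refine lt_of_pow_lt_pow_left₀ d (by positivity) (hlo.trans_eq ?_)
    rw [← hρX, hm]; ring
  have hcont : Continuous (levelTerm E D d N) := by unfold levelTerm; fun_prop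
  -- all the strict inequalities persist near `ρ`
  have hev : ∀ᶠ r in 𝓝 ρ, 0 < r ∧ r < 1 ∧ (N = 0 ∨ D < r ^ (d ^ N * (d - 1))) ∧
      r ^ (m * (d - 1)) < D ∧ D * levelTerm E D d N r < κ := by
    refine (lt_mem_nhds hρ0).and ((gt_mem_nhds hρ1).and (Eventually.and ?_ (Eventually.and ?_ ?_)))
    · rcases hρlo with h0 | h0
      · exact Eventually.of_forall fun _ => Or.inl h0
      · exact (((continuous_pow _).tendsto ρ).eventually_const_lt h0).mono fun _ => Or.inr
    · exact ((continuous_pow _).tendsto ρ).eventually_lt_const hρhi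
    · refine ((hcont.const_mul D).tendsto ρ).eventually_lt_const ?_
      simp only [hρlev]
      exact mul_lt_of_lt_one_left hκ.pos hd1
  obtain ⟨δ, hδ, hball⟩ := Metric.eventually_nhds_iff.1 hev
  have hmono : ∀ {r r' : ℝ}, 0 < r → r < r' → levelTerm E D d N r < levelTerm E D d N r' := by
    intro r r' hr hrr'
    unfold levelTerm
    have := pow_lt_pow_left₀ hrr' hr.le hm0
    gcongr
  obtain ⟨y, hy0, hy1, hy2⟩ := exists_norm_between (K := K) (a := max (ρ / 2) (ρ - δ)) (b := ρ)
    (by positivity) (max_lt (by linarith) (by linarith))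
  obtain ⟨s, hs0, hs1, hs2⟩ := exists_norm_between (K := K) (a := max (ρ / 2) (ρ - δ)) (b := ‖y‖)
    (by positivity) hy1
  obtain ⟨R, hR0, hR1, hR2⟩ := exists_norm_between (K := K) (a := ρ) (b := ρ + δ) hρ0 (by linarith)
  have hyδ := (le_max_right _ _).trans_lt hy1
  have hsδ := (le_max_right _ _).trans_lt hs1
  obtain ⟨hyp, hyl1, hylo, hyhi, -⟩ := hball (y := ‖y‖) (by
    rw [Real.dist_eq, abs_sub_lt_iff]; constructor <;> linarith)
  obtain ⟨hsp, hsl1, hslo, hshi, -⟩ := hball (y := ‖s‖) (by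
    rw [Real.dist_eq, abs_sub_lt_iff]; constructor <;> linarith)
  obtain ⟨hRp, hRl1, hRlo, hRhi, hRκ⟩ := hball (y := ‖R‖) (by
    rw [Real.dist_eq, abs_sub_lt_iff]; constructor <;> linarith)
  have hylt : levelTerm E D d N ‖y‖ < κ := hρlev ▸ hmono hyp hy2
  have hslt : levelTerm E D d N ‖s‖ < κ := hρlev ▸ hmono hsp (hs2.trans hy2)
  have hRgt : κ < levelTerm E D d N ‖R‖ := hρlev ▸ hmono hρ0 hR1
  have hAy := h.norm_eq_levelTerm hd hκ hd1 he N y hy0 hyl1 hylt hylo hyhi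
  -- a term of `A` that dominates at radius `‖y‖`
  obtain ⟨j, hj⟩ : ∃ j, levelTerm E D d N ‖y‖ ≤ ‖a j‖ * ‖y‖ ^ (j + 1) := by
    by_contra! hall
    refine (hasSum_norm_lt (levelTerm_pos hE hD hyp N) (h.hasSum y hy0 hyl1) fun k => ?_).ne hAy
    rw [norm_mul, norm_pow]; exact hall k
  have hjs := h.upper_bound hd hκ hd1 hs0 hsl1 (levelTerm_pos hE hD hsp N) hslt
    (levelTerm_le hE hD hd0 hsp hsl1 hslo hshi.le) j
  set Q := E / D ^ (N + 1) with hQ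
  have hQ0 : 0 < Q := by positivity
  have hlevQ : ∀ r, levelTerm E D d N r = Q * r ^ m := by
    intro r; rw [hQ]; unfold levelTerm; ring
  rw [hlevQ] at hj hjs
  have haj : 0 < ‖a j‖ := by
    by_contra! hneg
    have h0 : ‖a j‖ = 0 := le_antisymm hneg (norm_nonneg _)
    rw [h0, zero_mul] at hj
    exact absurd hj (not_le.2 (by positivity))
  -- comparing the radii `‖s‖ < ‖y‖` shows that this term has degree at least `m`
  have hjm : m ≤ j + 1 := by
    have hq : 1 < ‖y‖ / ‖s‖ := (one_lt_div hsp).2 hs2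
    refine (pow_le_pow_iff_right₀ hq).1 ?_
    rw [div_pow, div_pow, div_le_div_iff₀ (by positivity) (by positivity)]
    have h1 := mul_le_mul hj hjs (by positivity) (by positivity)
    have h2 : (Q * ‖a j‖) * (‖y‖ ^ m * ‖s‖ ^ (j + 1))
        ≤ (Q * ‖a j‖) * (‖y‖ ^ (j + 1) * ‖s‖ ^ m) := by
      calc _ = Q * ‖y‖ ^ m * (‖a j‖ * ‖s‖ ^ (j + 1)) := by ring
        _ ≤ _ := h1
        _ = _ := by ring
    exact le_of_mul_le_mul_left h2 (by positivity)
  have hRbig : levelTerm E D d N ‖R‖ ≤ ‖a j‖ * ‖R‖ ^ (j + 1) := by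
    have hq : 1 ≤ ‖R‖ / ‖y‖ := (one_le_div hyp).2 (hy2.trans hR1).le
    have h1 : (‖R‖ / ‖y‖) ^ m ≤ (‖R‖ / ‖y‖) ^ (j + 1) := pow_le_pow_right₀ hq hjm
    have h2 := mul_le_mul hj h1 (by positivity) (by positivity)
    rw [hlevQ]
    calc Q * ‖R‖ ^ m = Q * ‖y‖ ^ m * (‖R‖ / ‖y‖) ^ m := by rw [div_pow]; field_simp
      _ ≤ _ := h2
      _ = _ := by rw [div_pow]; field_simp
  have hall := levelTerm_le hE hD hd0 hRp hRl1 hRlo hRhi.le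
  have hLp := levelTerm_pos (d := d) hE hD hRp N
  have hRd := h.upper_bound hd hκ hd1 (x₀ := R ^ d) (pow_ne_zero _ hR0)
    (by rw [norm_pow]; exact pow_lt_one₀ (norm_nonneg _) hRl1 hd0.ne') (mul_pos hD hLp) hRκ
    (fun n => by
      rw [norm_pow, levelTerm_pow hD]
      exact mul_le_mul_of_nonneg_left (hall _) hD.le)
  have hfinal := h.term_bound hd0 hκ hR0 hRl1 (B := D * levelTerm E D d N ‖R‖)
    (h.rhs_bound hd0 hR0 hRl1
    (by rw [← levelTerm_zero hD]; exact mul_le_mul_of_nonneg_left (hall 0) hD.le)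
    (fun k => by have := hRd k; rwa [norm_pow] at this)) j
  have h4 := le_of_mul_le_mul_left (hfinal.trans_eq (mul_assoc _ _ _)) hD
  set L := levelTerm E D d N ‖R‖
  have h5 : L * L ≤ L * κ :=
    (mul_le_mul hRbig (hRbig.trans (le_max_left _ _)) hLp.le (by positivity)).trans h4
  exact absurd (le_of_mul_le_mul_left h5 hLp) (not_le.2 hRgt)

end IsBottcherSolution

end Core

/-! ### Zero-free analytic functions -/

section Monomial

variable {K : Type*} [NontriviallyNormedField K] [IsUltrametricDist K]

/-- A polynomial without zeros on an annulus has the size of a monomial there. -/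
lemma exists_norm_eval_eq [IsAlgClosed K] {P : K[X]} {s S : ℝ}
    (hP : ∀ z, s ≤ ‖z‖ → ‖z‖ ≤ S → P.eval z ≠ 0) :
    ∃ (C : ℝ) (k : ℕ), 0 < C ∧ ∀ z, s ≤ ‖z‖ → ‖z‖ ≤ S → ‖P.eval z‖ = C * ‖z‖ ^ k := by
  by_cases hP0 : P = 0
  · exact ⟨1, 0, one_pos, fun z h1 h2 => absurd (by simp [hP0]) (hP z h1 h2)⟩
  have hprod : ∀ M : Multiset K, (∀ β ∈ M, ‖β‖ < s ∨ S < ‖β‖) → ∃ (C : ℝ) (k : ℕ), 0 < C ∧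
      ∀ z, s ≤ ‖z‖ → ‖z‖ ≤ S → ‖(M.map fun β => z - β).prod‖ = C * ‖z‖ ^ k := by
    intro M
    induction M using Multiset.induction with
    | empty => intro _; exact ⟨1, 0, one_pos, fun z _ _ => by simp⟩
    | cons β M ih =>
      intro h
      obtain ⟨C, k, hC, hk⟩ := ih fun b hb => h b (Multiset.mem_cons_of_mem hb)
      rcases h β (Multiset.mem_cons_self _ _) with hβ | hβ
      · refine ⟨C, k + 1, hC, fun z h1 h2 => ?_⟩
        rw [Multiset.map_cons, Multiset.prod_cons, norm_mul, hk z h1 h2,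
          norm_sub_eq_left (hβ.trans_le h1)]
        ring
      · by_cases hβ0 : β = 0
        · exact ⟨1, 0, one_pos, fun z _ h2 => absurd (h2.trans_lt hβ)
            (by rw [hβ0, norm_zero]; exact not_lt.2 (norm_nonneg _))⟩
        · refine ⟨‖β‖ * C, k, mul_pos (norm_pos_iff.2 hβ0) hC, fun z h1 h2 => ?_⟩
          rw [Multiset.map_cons, Multiset.prod_cons, norm_mul, hk z h1 h2,
            norm_sub_eq_right (h2.trans_lt hβ), mul_assoc]
  obtain ⟨C, k, hC, hk⟩ := hprod P.roots fun β hβ => by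
    by_contra! hcon
    exact hP β hcon.1 hcon.2 ((mem_roots hP0).1 hβ)
  refine ⟨‖P.leadingCoeff‖ * C, k, mul_pos (norm_pos_iff.2 (leadingCoeff_ne_zero.2 hP0)) hC,
    fun z h1 h2 => ?_⟩
  have he : P.eval z = P.leadingCoeff * (P.roots.map fun β => z - β).prod := by
    conv_lhs => rw [(IsAlgClosed.splits P).eq_prod_roots]
    rw [eval_mul, eval_C, eval_multiset_prod, Multiset.map_map]
    simp
  rw [he, norm_mul, hk z h1 h2, mul_assoc]

lemma LaurentApprox.exists_norm_eq [IsAlgClosed K] {F : K → K} {s S : ℝ} (hs : 0 < s)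
    (hF : LaurentApprox F s S) (h1F : ∀ z, s ≤ ‖z‖ → ‖z‖ ≤ S → 1 < ‖F z‖) :
    ∃ (C : ℝ) (k : ℤ), 0 < C ∧ ∀ z, s ≤ ‖z‖ → ‖z‖ ≤ S → ‖F z‖ = C * ‖z‖ ^ k := by
  obtain ⟨P, m, hP⟩ := hF 1 one_pos
  have heq : ∀ z, s ≤ ‖z‖ → ‖z‖ ≤ S → ‖P.eval z / z ^ m‖ = ‖F z‖ := fun z h1 h2 => by
    rw [← sub_sub_self (F z) (P.eval z / z ^ m),
      norm_sub_eq_left ((hP z h1 h2).trans (h1F z h1 h2))]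
  obtain ⟨C, k, hC, hk⟩ := exists_norm_eval_eq (P := P) (s := s) (S := S) fun z h1 h2 h0 => by
    have := heq z h1 h2
    rw [h0, zero_div, norm_zero] at this
    linarith [h1F z h1 h2]
  refine ⟨C, (k : ℤ) - m, hC, fun z h1 h2 => ?_⟩
  rw [← heq z h1 h2, norm_div, hk z h1 h2, norm_pow,
    zpow_sub₀ (hs.trans_le h1).ne', zpow_natCast, zpow_natCast, mul_div_assoc]

/-- A zero-free semiconjugacy between two maps that scale norms by `d`-th powers has exactly the
size of a power of `z`: the constant `C` in `‖F z‖ = C ‖z‖ ^ k` satisfies `C ^ d = C`. -/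
lemma exists_norm_eq_zpow [IsAlgClosed K] {d : ℕ} (hd : 2 ≤ d) {F g h : K → K}
    (hF : ∀ s S, 1 < s → LaurentApprox F s S) (h1F : ∀ z, 1 < ‖z‖ → 1 < ‖F z‖)
    (hg : ∀ z, 1 < ‖z‖ → ‖g z‖ = ‖z‖ ^ d) (hh : ∀ z, 1 < ‖z‖ → ‖h z‖ = ‖z‖ ^ d)
    (hconj : ∀ z, 1 < ‖z‖ → F (g z) = h (F z)) :
    ∃ k : ℤ, 0 < k ∧ ∀ z, 1 < ‖z‖ → ‖F z‖ = ‖z‖ ^ k := by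
  -- a common exponent for two points, from an annulus that contains `z`, `w` and `g z`
  have key : ∀ z w, 1 < ‖z‖ → 1 < ‖w‖ → ∃ k : ℤ, ‖F z‖ = ‖z‖ ^ k ∧ ‖F w‖ = ‖w‖ ^ k := by
    intro z w hz hw
    have hs : 1 < min ‖z‖ ‖w‖ := lt_min hz hw
    have hzd : ‖z‖ ≤ ‖z‖ ^ d := le_self_pow₀ hz.le (by omega)
    obtain ⟨C, k, hC, hk⟩ := (hF (min ‖z‖ ‖w‖) (max (‖z‖ ^ d) ‖w‖) hs).exists_norm_eq
      (one_pos.trans hs) fun y hy _ => h1F y (hs.trans_le hy)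
    have e1 := hk z (min_le_left _ _) (hzd.trans (le_max_left _ _))
    have e2 := hk w (min_le_right _ _) (le_max_right _ _)
    have e3 := hk (g z) (by rw [hg z hz]; exact (min_le_left _ _).trans hzd)
      (by rw [hg z hz]; exact le_max_left _ _)
    rw [hconj z hz, hh _ (h1F z hz), e1, hg z hz, mul_pow, ← zpow_natCast (‖z‖ ^ k) d,
      ← zpow_natCast ‖z‖ d, ← zpow_mul, ← zpow_mul, mul_comm k] at e3
    have hCd := mul_right_cancel₀ (zpow_ne_zero _ (by linarith)) e3
    obtain ⟨n, rfl⟩ : ∃ n, d = n + 1 := ⟨d - 1, by omega⟩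
    rw [pow_succ, mul_eq_right₀ hC.ne'] at hCd
    have hC1 : C = 1 := (pow_eq_one_iff_of_nonneg hC.le (by omega)).1 hCd
    rw [hC1, one_mul] at e1 e2
    exact ⟨k, e1, e2⟩
  obtain ⟨z₀, hz₀⟩ := NormedField.exists_one_lt_norm K
  obtain ⟨k, hk, -⟩ := key z₀ z₀ hz₀ hz₀
  refine ⟨k, ?_, fun z hz => ?_⟩
  · rw [← one_lt_zpow_iff_right₀ hz₀, ← hk]; exact h1F z₀ hz₀
  · obtain ⟨l, hl, hl'⟩ := key z₀ z hz₀ hz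
    rw [hk] at hl
    rw [hl', zpow_right_injective₀ (by linarith) hz₀.ne' hl]

end Monomial

/-! ### The field `ℂ_p` -/

section Padic

variable {p : ℕ} [hp : Fact p.Prime]

lemma norm_natCast {n : ℕ} (hn : n ≠ 0) :
    ‖(n : ℂ_[p])‖ = (p : ℝ) ^ (-(padicValNat p n : ℝ)) := by
  have h := PadicComplex.norm_extends' p (n : ℚ_[p])
  rw [Padic.norm_eq_zpow_neg_valuation (by exact_mod_cast hn), Padic.valuation_natCast] at h
  rw [Real.rpow_neg (by positivity), Real.rpow_natCast, ← zpow_natCast, ← zpow_neg, ← h]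
  congr 1
  simp

lemma norm_prime : ‖(p : ℂ_[p])‖ = (p : ℝ) ^ (-1 : ℝ) := by
  rw [norm_natCast hp.out.ne_zero, padicValNat_self, Nat.cast_one]

lemma norm_natCast_eq_one {n : ℕ} (hn : n ≠ 0) (h : ¬ p ∣ n) : ‖(n : ℂ_[p])‖ = 1 := by
  rw [norm_natCast hn, padicValNat.eq_zero_of_not_dvd h]
  simp

/-- The root gap is attained by the primitive `p`-th roots of unity. Any other root of unity has a
power of prime order, which is no farther from `1`. -/
lemma isRootGap {d : ℕ} (hd : 0 < d) (hpd : p ∣ d) :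
    IsRootGap ℂ_[p] d ((p : ℝ) ^ (-(1 / ((p : ℝ) - 1)))) := by
  have hp2 := hp.out.two_le
  have hp0 : (0 : ℝ) < p := by exact_mod_cast hp.out.pos
  have hp1 : (0 : ℝ) < (p : ℝ) - 1 := by
    have : (2 : ℝ) ≤ p := by exact_mod_cast hp2
    linarith
  have hκ : ∀ w : ℂ_[p], IsPrimitiveRoot w p → ‖1 - w‖ = (p : ℝ) ^ (-(1 / ((p : ℝ) - 1))) := by
    intro w hw
    have h := norm_one_sub_pow_prime hp.out hw
    rw [norm_prime] at h
    refine (pow_left_inj₀ (norm_nonneg _) (by positivity) (n := p - 1) (by omega)).1 ?_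
    rw [h, ← Real.rpow_natCast, ← Real.rpow_mul hp0.le, Nat.cast_sub hp.out.one_le, Nat.cast_one]
    congr 1
    field_simp
  refine ⟨by positivity, fun w hw hw1 => ?_, ?_⟩
  · have hord : orderOf w ≠ 1 := fun h => hw1 (orderOf_eq_one_iff.1 h)
    have hpos : 0 < orderOf w := orderOf_pos_iff.2 (isOfFinOrder_iff_pow_eq_one.2 ⟨d, hd, hw⟩)
    obtain ⟨l, hl, m, hm⟩ := Nat.exists_prime_and_dvd hord
    have hη := (IsPrimitiveRoot.orderOf w).pow hpos (hm.trans (mul_comm _ _))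
    refine le_trans ?_ (norm_one_sub_pow_le (norm_eq_one_of_pow hd.ne' hw) m)
    by_cases hlp : l = p
    · subst hlp; exact (hκ _ hη).ge
    · have h1 := norm_one_sub_eq_one (norm_natCast_eq_one hl.ne_zero fun h =>
        hlp ((Nat.prime_dvd_prime_iff_eq hp.out hl).1 h).symm) hη one_pos hl.one_lt
      rw [pow_one] at h1
      rw [h1]
      exact Real.rpow_le_one_of_one_le_of_nonpos (by exact_mod_cast hp.out.one_le)
        (by rw [neg_nonpos]; positivity)
  · have : NeZero (p : ℂ_[p]) := ⟨by exact_mod_cast hp.out.ne_zero⟩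
    obtain ⟨ζ, hζ⟩ := HasEnoughRootsOfUnity.exists_primitiveRoot ℂ_[p] p
    refine ⟨ζ, ?_, hζ.ne_one hp.out.one_lt, hκ ζ hζ⟩
    obtain ⟨k, rfl⟩ := hpd
    rw [pow_mul, hζ.pow_eq_one, one_pow]

/-! ### Basins and conjugacies -/

lemma norm_f {d : ℕ} (hd : 2 ≤ d) {c z : ℂ_[p]} (hz : 1 < ‖z‖) (hc : ‖c‖ ≤ ‖z‖) :
    ‖f d c z‖ = ‖z‖ ^ d := by
  unfold f
  rw [norm_sub_eq_left, norm_pow]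
  rw [norm_pow]
  exact hc.trans_lt (lt_self_pow₀ hz (by omega))

lemma mem_basin {d : ℕ} (hd : 2 ≤ d) {c z : ℂ_[p]} (hz : 1 < ‖z‖) (hc : ‖c‖ ≤ ‖z‖) :
    z ∈ basin d c := by
  have key : ∀ n : ℕ, ‖(f d c)^[n] z‖ = ‖z‖ ^ d ^ n := by
    intro n
    induction n with
    | zero => simp
    | succ n ih =>
      have hle : ‖z‖ ≤ ‖z‖ ^ d ^ n := le_self_pow₀ hz.le (by positivity)
      rw [Function.iterate_succ_apply', norm_f hd (by rw [ih]; exact hz.trans_le hle)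
        (by rw [ih]; exact hc.trans hle), ih, ← pow_mul, pow_succ]
  simp only [basin, Set.mem_ofPred_eq, key]
  exact (tendsto_pow_atTop_atTop_of_one_lt hz).comp
    (tendsto_pow_atTop_atTop_of_one_lt (by omega : 1 < d))

lemma f_mem_basin_iff {d : ℕ} {c z : ℂ_[p]} : f d c z ∈ basin d c ↔ z ∈ basin d c := by
  simp only [basin, Set.mem_ofPred_eq, ← Function.iterate_succ_apply]
  exact tendsto_add_atTop_iff_nat (f := fun n => ‖(f d c)^[n] z‖) 1

lemma basin_eq {d : ℕ} (hd : 2 ≤ d) {c : ℂ_[p]} (hc : ‖c‖ ≤ 1) : basin d c = {z | 1 < ‖z‖} := by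
  refine Set.Subset.antisymm (fun z hz => ?_) fun z hz => mem_basin hd hz (hc.trans hz.le)
  by_contra hz1
  have key : ∀ n : ℕ, ‖(f d c)^[n] z‖ ≤ 1 := by
    intro n
    induction n with
    | zero => exact not_lt.1 hz1
    | succ n ih =>
      rw [Function.iterate_succ_apply']
      exact norm_sub_le_of_le (by rw [norm_pow]; exact pow_le_one₀ (norm_nonneg _) ih) hc
  obtain ⟨n, hn⟩ := ((tendsto_atTop.1 hz) 2).exists
  linarith [key n]

/-- If `‖c₂‖ > 1`, the critical point `0` escapes, so that `-c₂` has a single preimage in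
`B(c₂)`, whereas every point of `B(c₁)` has `d` preimages. -/
lemma not_conjugate_of_one_lt_norm {d : ℕ} (hd : 2 ≤ d) {c₁ c₂ : ℂ_[p]} (hc₁ : ‖c₁‖ ≤ 1)
    (hc₂ : 1 < ‖c₂‖) : ¬ AnalyticallyConjugate d c₁ c₂ := by
  rintro ⟨Φ, -, hbij, -, -, -, hconj⟩
  have hf0 : f d c₂ 0 = -c₂ := by rw [f, zero_pow (by omega), zero_sub]
  have hmem : -c₂ ∈ basin d c₂ := mem_basin hd (by rwa [norm_neg]) (by rw [norm_neg])
  obtain ⟨w, hw, hΦw⟩ := hbij.surjOn hmem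
  have hw1 : 1 < ‖w‖ := by rwa [basin_eq hd hc₁] at hw
  have hwc : w + c₁ ≠ 0 := by
    rw [← norm_pos_iff, norm_add_eq_left (hc₁.trans_lt hw1)]; linarith
  obtain ⟨z, hz⟩ := IsAlgClosed.exists_pow_nat_eq (w + c₁) (show 0 < d by omega)
  have hz0 : z ≠ 0 := by
    rintro rfl
    exact hwc (hz ▸ zero_pow (by omega))
  have : NeZero (d : ℂ_[p]) := ⟨by exact_mod_cast (by omega : d ≠ 0)⟩
  obtain ⟨ω, hω⟩ := HasEnoughRootsOfUnity.exists_primitiveRoot ℂ_[p] d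
  have hpre : ∀ y : ℂ_[p], y ^ d = w + c₁ → y ∈ basin d c₁ ∧ Φ y = 0 := by
    intro y hy
    have hfy : f d c₁ y = w := by rw [f, hy, add_sub_cancel_right]
    have hyb : y ∈ basin d c₁ := f_mem_basin_iff.1 (hfy ▸ hw)
    refine ⟨hyb, ?_⟩
    have h := hconj y hyb
    rw [hfy, hΦw, f, sub_eq_neg_self] at h
    exact pow_eq_zero_iff (by omega) |>.1 h
  have h1 := hpre z hz
  have h2 := hpre (ω * z) (by rw [mul_pow, hω.pow_eq_one, one_mul, hz])
  have h3 := hbij.injOn h1.1 h2.1 (h1.2.trans h2.2.symm)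
  exact hω.ne_one (by omega) (mul_right_cancel₀ hz0 (by rw [one_mul, ← h3]))

lemma RigidAnalyticOn.laurentApprox {F : ℂ_[p] → ℂ_[p]}
    (hF : RigidAnalyticOn F {z | 1 < ‖z‖}) {s : ℝ} (S : ℝ) (hs : 1 < s) :
    LaurentApprox F s S := by
  -- radii in the value group enclosing `[s, S]`
  obtain ⟨σ, hσ0, hσ1, hσ2⟩ := exists_norm_between (K := ℂ_[p]) one_pos hs
  obtain ⟨ρ, hρ⟩ := NormedField.exists_lt_norm ℂ_[p] (max S 0)
  have hρ0 : ρ ≠ 0 := norm_pos_iff.1 ((le_max_right _ _).trans_lt hρ)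
  refine laurentApprox_of_rational (one_pos.trans hs) fun ε hε => ?_
  obtain ⟨P, Q, hPQ⟩ := hF {z | ‖z - 0‖ ≤ ‖ρ‖ ∧ ∀ h ∈ ({(0, σ)} : Finset (ℂ_[p] × ℂ_[p])),
      ‖h.2‖ ≤ ‖z - h.1‖} ⟨0, ρ, {(0, σ)}, hρ0, by simpa using hσ0, rfl⟩
    (fun z hz => by
      have := hz.2 (0, σ) (Finset.mem_singleton_self _)
      simp only [sub_zero] at this
      exact hσ1.trans_le this) ε hε
  refine ⟨P, Q, fun z h1 h2 => hPQ z ⟨?_, fun h hh => ?_⟩⟩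
  · rw [sub_zero]; exact h2.trans ((le_max_left _ _).trans_lt hρ).le
  · rw [Finset.mem_singleton.1 hh, sub_zero]; exact hσ2.le.trans h1

/-- A conjugacy between basins `{‖z‖ > 1}` preserves norms. -/
lemma norm_conjugacy {d : ℕ} (hd : 2 ≤ d) {c₁ c₂ : ℂ_[p]} (hc₁ : ‖c₁‖ ≤ 1) (hc₂ : ‖c₂‖ ≤ 1)
    {Φ Ψ : ℂ_[p] → ℂ_[p]} (hbij : Set.BijOn Φ {z | 1 < ‖z‖} {z | 1 < ‖z‖})
    (hinv : Set.InvOn Ψ Φ {z | 1 < ‖z‖} {z | 1 < ‖z‖})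
    (hΦ : RigidAnalyticOn Φ {z | 1 < ‖z‖}) (hΨ : RigidAnalyticOn Ψ {z | 1 < ‖z‖})
    (hconj : ∀ z, 1 < ‖z‖ → f d c₂ (Φ z) = Φ (f d c₁ z)) {z : ℂ_[p]} (hz : 1 < ‖z‖) :
    ‖Φ z‖ = ‖z‖ := by
  have hf : ∀ c : ℂ_[p], ‖c‖ ≤ 1 → ∀ z, 1 < ‖z‖ → ‖f d c z‖ = ‖z‖ ^ d :=
    fun c hc z hz => norm_f hd hz (hc.trans hz.le)
  have hf1 : ∀ z : ℂ_[p], 1 < ‖z‖ → 1 < ‖f d c₁ z‖ := fun z hz => by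
    rw [hf c₁ hc₁ z hz]; exact one_lt_pow₀ hz (by omega)
  have hΨmaps : ∀ w, 1 < ‖w‖ → 1 < ‖Ψ w‖ := fun w hw => by
    obtain ⟨y, hy, rfl⟩ := hbij.surjOn hw
    rw [hinv.1 hy]; exact hy
  obtain ⟨k, hk0, hk⟩ := exists_norm_eq_zpow hd (fun s S hs => hΦ.laurentApprox S hs)
    (fun z hz => hbij.mapsTo hz) (hf c₁ hc₁) (hf c₂ hc₂) fun z hz => (hconj z hz).symm
  obtain ⟨l, hl0, hl⟩ := exists_norm_eq_zpow hd (fun s S hs => hΨ.laurentApprox S hs)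
    hΨmaps (hf c₂ hc₂) (hf c₁ hc₁) fun w hw => by
      obtain ⟨y, hy, rfl⟩ := hbij.surjOn hw
      rw [hconj y hy, hinv.1 hy, hinv.1 (hf1 y hy)]
  have h := hl (Φ z) (hbij.mapsTo hz)
  rw [hinv.1 hz, hk z hz, ← zpow_mul] at h
  have hkl : k * l = 1 :=
    (zpow_right_injective₀ (by linarith) hz.ne' (h.symm.trans (zpow_one _).symm))
  rw [hk z hz, Int.eq_one_of_mul_eq_one_right hk0.le hkl, zpow_one]

/-- A conjugacy between basins `{‖z‖ > 1}` gives a solution of the Böttcher equation. -/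
lemma exists_isBottcherSolution {d : ℕ} (hd : 2 ≤ d) {c₁ c₂ : ℂ_[p]} (hc₁ : ‖c₁‖ ≤ 1)
    (hc₂ : ‖c₂‖ ≤ 1) {Φ : ℂ_[p] → ℂ_[p]} (hΦ : RigidAnalyticOn Φ {z | 1 < ‖z‖})
    (hconj : ∀ z, 1 < ‖z‖ → f d c₂ (Φ z) = Φ (f d c₁ z))
    (hnorm : ∀ z, 1 < ‖z‖ → ‖Φ z‖ = ‖z‖) :
    ∃ (l : ℂ_[p]) (a : ℕ → ℂ_[p]) (A : ℂ_[p] → ℂ_[p]), l ^ (d - 1) = 1 ∧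
      IsBottcherSolution d c₁ (c₂ / l - c₁) a A := by
  set u : ℂ_[p] → ℂ_[p] := fun z => Φ z * (z - 0)⁻¹ with hu
  have hu1 : ∀ z, 1 < ‖z‖ → ‖u z‖ = 1 := fun z hz => by
    simp only [hu, norm_mul, norm_inv, sub_zero, hnorm z hz]
    exact mul_inv_cancel₀ (by linarith)
  obtain ⟨a, ha, hsum⟩ := exists_powerSeries (F := u)
    (fun s S hs => (hΦ.laurentApprox S hs).mul (one_pos.trans hs)
      (laurentApprox_inv_sub (one_pos.trans hs) (Or.inl (by rw [norm_zero]; linarith))))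
    fun z hz => (hu1 z hz).le
  have hxi : ∀ x : ℂ_[p], x ≠ 0 → ‖x‖ < 1 → 1 < ‖x⁻¹‖ := fun x hx0 hx1 => by
    rw [norm_inv]; exact (one_lt_inv₀ (norm_pos_iff.2 hx0)).2 hx1
  have hsum' : ∀ x, x ≠ 0 → ‖x‖ < 1 → HasSum (fun k => a (k + 1) * x ^ (k + 1)) (u x⁻¹ - a 0) :=
    fun x hx0 hx1 => by
      have := (hasSum_nat_add_iff' 1).2 (hsum x hx0 hx1)
      simpa using this
  have hclose : ∀ x, x ≠ 0 → ‖x‖ < 1 → ‖u x⁻¹ - a 0‖ ≤ ‖x‖ := fun x hx0 hx1 =>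
    hasSum_norm_le (hsum' x hx0 hx1) fun k => by
      rw [norm_mul, norm_pow]
      exact (mul_le_of_le_one_left (by positivity) (ha _)).trans
        (pow_le_of_le_one (norm_nonneg _) hx1.le (Nat.succ_ne_zero k))
  have hd0 : d ≠ 0 := by omega
  have hone : ∀ x : ℂ_[p], ‖x‖ < 1 → ‖1 - c₁ * x ^ d‖ = 1 := fun x hx => by
    rw [norm_sub_eq_left, norm_one]
    rw [norm_one, norm_mul, norm_pow]
    exact (mul_le_of_le_one_left (by positivity) hc₁).trans_lt
      (pow_lt_one₀ (norm_nonneg _) hx hd0)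
  have hone' : ∀ x : ℂ_[p], ‖x‖ < 1 → 1 - c₁ * x ^ d ≠ 0 := fun x hx =>
    norm_pos_iff.1 (by rw [hone x hx]; exact one_pos)
  have hx'0 : ∀ x : ℂ_[p], x ≠ 0 → ‖x‖ < 1 → x ^ d / (1 - c₁ * x ^ d) ≠ 0 := fun x hx0 hx1 =>
    div_ne_zero (pow_ne_zero _ hx0) (hone' x hx1)
  have hx'n : ∀ x : ℂ_[p], ‖x‖ < 1 → ‖x ^ d / (1 - c₁ * x ^ d)‖ = ‖x‖ ^ d := fun x hx1 => by
    rw [norm_div, hone x hx1, div_one, norm_pow]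
  -- the conjugacy equation in the coordinate `x = 1 / z`
  have heqn : ∀ x : ℂ_[p], x ≠ 0 → ‖x‖ < 1 → u x⁻¹ ^ d
      = (1 - c₁ * x ^ d) * u (x ^ d / (1 - c₁ * x ^ d))⁻¹ + c₂ * x ^ d := by
    intro x hx0 hx1
    have h := hconj x⁻¹ (hxi x hx0 hx1)
    have h1 := hone' x hx1
    have h2 : f d c₁ x⁻¹ = (x ^ d / (1 - c₁ * x ^ d))⁻¹ := by
      rw [f, inv_div, inv_pow]; field_simp
    rw [h2] at h
    have h3 : Φ (x ^ d / (1 - c₁ * x ^ d))⁻¹ = Φ x⁻¹ ^ d - c₂ := h.symm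
    simp only [hu, sub_zero, inv_inv, h3, mul_pow]
    rw [mul_left_comm, mul_div_cancel₀ _ h1]
    ring
  obtain ⟨w, hw⟩ := NormedField.exists_norm_lt_one ℂ_[p]
  have hl1 : ‖a 0‖ = 1 := by
    rw [← sub_sub_self (u w⁻¹) (a 0), norm_sub_eq_left, hu1 _ (hxi w (norm_pos_iff.1 hw.1) hw.2)]
    rw [hu1 _ (hxi w (norm_pos_iff.1 hw.1) hw.2)]
    exact (hclose w (norm_pos_iff.1 hw.1) hw.2).trans_lt hw.2
  have hl0 : a 0 ≠ 0 := norm_pos_iff.1 (by rw [hl1]; exact one_pos)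
  -- letting `x` tend to `0` in the equation
  have hld : a 0 ^ d = a 0 := by
    rw [← sub_eq_zero]
    by_contra hne
    obtain ⟨x, hx0, hx1, hx2⟩ := exists_norm_between (K := ℂ_[p])
      (a := min 1 ‖a 0 ^ d - a 0‖ / 2) (b := min 1 ‖a 0 ^ d - a 0‖)
      (half_pos (lt_min one_pos (norm_pos_iff.2 hne)))
      (half_lt_self (lt_min one_pos (norm_pos_iff.2 hne)))
    have hxl : ‖x‖ < 1 := hx2.trans_le (min_le_left _ _)
    have hxd : ‖x‖ ^ d ≤ ‖x‖ := pow_le_of_le_one (norm_nonneg _) hxl.le hd0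
    refine absurd (hx2.trans_le (min_le_right _ _)) (not_lt.2 ?_)
    have hx'1 : ‖x ^ d / (1 - c₁ * x ^ d)‖ < 1 := by
      rw [hx'n x hxl]; exact hxd.trans_lt hxl
    set v := u (x ^ d / (1 - c₁ * x ^ d))⁻¹ with hv
    have hv1 : ‖v‖ = 1 := hu1 _ (hxi _ (hx'0 x hx0 hxl) hx'1)
    have hva : ‖v - a 0‖ ≤ ‖x‖ :=
      (hclose _ (hx'0 x hx0 hxl) hx'1).trans (by rw [hx'n x hxl]; exact hxd)
    have hsplit : a 0 ^ d - a 0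
        = (v - a 0) - (u x⁻¹ ^ d - a 0 ^ d) + (c₂ - c₁ * v) * x ^ d := by
      rw [heqn x hx0 hxl]; ring
    rw [hsplit]
    refine norm_add_le_of_le (norm_sub_le_of_le hva ?_) ?_
    · have hgs := (Commute.all (u x⁻¹) (a 0)).geom_sum₂_mul d
      rw [← hgs, norm_mul]
      refine (mul_le_of_le_one_left (norm_nonneg _) ?_).trans (hclose x hx0 hxl)
      refine IsUltrametricDist.norm_sum_le_of_forall_le_of_nonneg zero_le_one fun i _ => ?_
      rw [norm_mul, norm_pow, norm_pow, hu1 _ (hxi x hx0 hxl), hl1, one_pow, one_pow, one_mul]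
    · rw [norm_mul, norm_pow]
      refine (mul_le_of_le_one_left (by positivity) ?_).trans hxd
      exact norm_sub_le_of_le hc₂ (by rw [norm_mul, hv1, mul_one]; exact hc₁)
  refine ⟨a 0, fun k => a (k + 1) / a 0, fun x => (u x⁻¹ - a 0) / a 0, ?_, hc₁, fun k => ?_,
    fun x hx0 hx1 => ?_, fun x hx0 hx1 => ?_⟩
  · refine mul_right_cancel₀ hl0 ?_
    rw [← pow_succ, Nat.sub_add_cancel (by omega), hld, one_mul]
  · rw [norm_div, hl1, div_one]; exact ha _
  · have := (hsum' x hx0 hx1).div_const (a 0)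
    simpa only [div_mul_eq_mul_div] using this
  · have h1 : (1 : ℂ_[p]) + (u x⁻¹ - a 0) / a 0 = u x⁻¹ / a 0 := by field_simp; ring
    rw [h1, div_pow, hld, heqn x hx0 hx1]
    field_simp
    ring

/-! ### Valuations -/

lemma vp_of_ne_zero {x : ℂ_[p]} (hx : x ≠ 0) :
    vp p x = ((-Real.logb (p : ℝ) ‖x‖ : ℝ) : EReal) := by
  simp [vp, hx]

lemma norm_eq_rpow {x : ℂ_[p]} (hx : x ≠ 0) :
    ‖x‖ = (p : ℝ) ^ (-(-Real.logb (p : ℝ) ‖x‖)) := by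
  have hp0 : (0 : ℝ) < p := by exact_mod_cast hp.out.pos
  have hp1 : (p : ℝ) ≠ 1 := by exact_mod_cast hp.out.ne_one
  rw [neg_neg, Real.rpow_logb hp0 hp1 (norm_pos_iff.2 hx)]

lemma norm_le_one_of_vp_nonneg {x : ℂ_[p]} (h : 0 ≤ vp p x) : ‖x‖ ≤ 1 := by
  by_cases hx : x = 0
  · simp [hx]
  · rw [vp_of_ne_zero hx, ← EReal.coe_zero, EReal.coe_le_coe_iff] at h
    rw [norm_eq_rpow hx]
    exact Real.rpow_le_one_of_one_le_of_nonpos (by exact_mod_cast hp.out.one_le) (by linarith)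

lemma norm_eq_of_vp_eq {x y : ℂ_[p]} (hy : y ≠ 0) (h : vp p x = vp p y) : ‖x‖ = ‖y‖ := by
  rw [vp_of_ne_zero hy] at h
  have hx : x ≠ 0 := by
    rintro rfl
    simp only [vp, if_true] at h
    exact EReal.top_ne_coe _ h
  rw [vp_of_ne_zero hx, EReal.coe_eq_coe_iff] at h
  rw [norm_eq_rpow hx, norm_eq_rpow hy, h]

lemma one_le_digits_sum (b : ℕ) {n : ℕ} (hn : n ≠ 0) : 1 ≤ (b.digits n).sum := by
  by_contra! h
  have h0 := List.sum_eq_zero_iff.1 (Nat.lt_one_iff.1 h)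
  exact Nat.getLast_digit_ne_zero b hn
    (h0 _ (List.getLast_mem (Nat.digits_ne_nil_iff_ne_zero.2 hn)))

/-- **Legendre's formula** for `(d - 1)!`, using `v_p(d!) = v_p((d - 1)!) + v_p(d)`. -/
lemma sub_one_mul_valuation {d : ℕ} (hd : 0 < d) :
    ((p : ℝ) - 1) * (padicValNat p (d - 1).factorial + padicValNat p d)
      = d - (p.digits d).sum := by
  have h := sub_one_mul_padicValNat_factorial (p := p) d
  have hf : d.factorial = d * (d - 1).factorial := (Nat.mul_factorial_pred hd.ne').symm
  rw [hf, padicValNat.mul hd.ne' (Nat.factorial_ne_zero _)] at h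
  have h2 := congrArg (Nat.cast (R := ℝ)) h
  rw [Nat.cast_sub (Nat.digit_sum_le p d), Nat.cast_mul, Nat.cast_sub hp.out.one_le, Nat.cast_add,
    Nat.cast_one] at h2
  rw [← h2]; ring

lemma factorial_valuation_le {d : ℕ} (hd : 2 ≤ d) :
    (padicValNat p (d - 1).factorial : ℝ) / ((d : ℝ) - 1)
      ≤ 1 / ((p : ℝ) - 1) - padicValNat p d / ((d : ℝ) - 1) := by
  have h := sub_one_mul_valuation (p := p) (show 0 < d by omega)
  have h1 : (1 : ℝ) ≤ ((p.digits d).sum : ℕ) := by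
    exact_mod_cast one_le_digits_sum p (show d ≠ 0 by omega)
  have hp1 : (0 : ℝ) < (p : ℝ) - 1 := sub_pos.2 (by exact_mod_cast hp.out.one_lt)
  have hd1 : (0 : ℝ) < (d : ℝ) - 1 := sub_pos.2 (by exact_mod_cast hd)
  rw [le_sub_iff_add_le, ← add_div, div_le_div_iff₀ hd1 hp1]
  linarith

lemma factorial_valuation_eq {d k : ℕ} (hd : 2 ≤ d) (hdk : d = p ^ k) :
    (padicValNat p (d - 1).factorial : ℝ) / ((d : ℝ) - 1)
      = 1 / ((p : ℝ) - 1) - padicValNat p d / ((d : ℝ) - 1) := by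
  have h := sub_one_mul_valuation (p := p) (show 0 < d by omega)
  have h1 : (p.digits d).sum = 1 := by
    have := Nat.digits_base_pow_mul (b := p) (k := k) (m := 1) hp.out.one_lt one_pos
    rw [mul_one, ← hdk, Nat.digits_of_lt p 1 one_ne_zero hp.out.one_lt] at this
    simp [this]
  rw [h1, Nat.cast_one] at h
  have hp1 : (0 : ℝ) < (p : ℝ) - 1 := sub_pos.2 (by exact_mod_cast hp.out.one_lt)
  have hd1 : (0 : ℝ) < (d : ℝ) - 1 := sub_pos.2 (by exact_mod_cast hd)
  rw [eq_sub_iff_add_eq, ← add_div, div_eq_div_iff hd1.ne' hp1.ne']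
  linarith

/-- Either condition confines `v = v_p(c)` to
`N v_p(d) + τ < v < (N + 1) v_p(d) + τ` with `τ = 1 / (p - 1) - v_p(d) / (d - 1)`, where the lower
bound is dropped for `N = 0`. -/
lemma condition_bounds {N d : ℕ} (hd : 2 ≤ d) {c : ℂ_[p]}
    (h : ConditionA p N d c ∨ ConditionB p N d c) :
    p ∣ d ∧ c ≠ 0 ∧
      -Real.logb p ‖c‖ < ((N : ℝ) + 1) * padicValNat p d
        + (1 / ((p : ℝ) - 1) - padicValNat p d / ((d : ℝ) - 1)) ∧
      (N = 0 ∨ (N : ℝ) * padicValNat p d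
        + (1 / ((p : ℝ) - 1) - padicValNat p d / ((d : ℝ) - 1)) < -Real.logb p ‖c‖) := by
  have hne : ∀ t : ℝ, vp p c < (t : EReal) → c ≠ 0 := by
    rintro t ht rfl
    simp [vp] at ht
  rcases h with ⟨rfl, hpd, hlt⟩ | ⟨hN, ⟨k, hk, hdk⟩, hlo, hhi⟩
  · have hc := hne _ hlt
    rw [vp_of_ne_zero hc, EReal.coe_lt_coe_iff, threshold] at hlt
    refine ⟨hpd, hc, ?_, Or.inl rfl⟩
    have := factorial_valuation_le (p := p) hd
    push_cast at hlt ⊢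
    linarith
  · have hc := hne _ hhi
    rw [vp_of_ne_zero hc, EReal.coe_lt_coe_iff, threshold, factorial_valuation_eq hd hdk] at hlo hhi
    refine ⟨hdk ▸ dvd_pow_self p (by omega), hc, ?_, Or.inr ?_⟩
    · push_cast at hhi; exact hhi
    · exact hlo

/-- The parameter `e` of the Böttcher equation has the size of `c₂`. -/
lemma norm_div_sub {n : ℕ} (hn : n ≠ 0) {c₁ c₂ l : ℂ_[p]} (hl : l ^ n = 1)
    (hv : ‖c₁ ^ n - c₂ ^ n‖ = ‖c₂ ^ n‖) (hc₂ : c₂ ≠ 0) : ‖c₂ / l - c₁‖ = ‖c₂‖ := by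
  have hle : ‖c₁‖ ≤ ‖c₂‖ := by
    by_contra! hlt
    have hpow : ‖c₂ ^ n‖ < ‖c₁ ^ n‖ := by
      rw [norm_pow, norm_pow]; exact pow_lt_pow_left₀ hlt (norm_nonneg _) hn
    rw [norm_sub_eq_left hpow] at hv
    exact hpow.ne' hv
  have hnl : ‖c₂ / l‖ = ‖c₂‖ := by rw [norm_div, norm_eq_one_of_pow hn hl, div_one]
  have hc₂p : 0 < ‖c₂‖ := norm_pos_iff.2 hc₂
  refine le_antisymm (norm_sub_le_of_le hnl.le hle) ?_
  -- `c₁ - c₂ / l` divides `c₁ ^ n - c₂ ^ n`, with a cofactor of size at most `‖c₂‖ ^ (n - 1)`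
  have hgs := (Commute.all c₁ (c₂ / l)).geom_sum₂_mul n
  rw [div_pow, hl, div_one] at hgs
  rw [← hgs, norm_mul, norm_sub_rev c₁, norm_pow] at hv
  have hsum : ‖∑ i ∈ Finset.range n, c₁ ^ i * (c₂ / l) ^ (n - 1 - i)‖ ≤ ‖c₂‖ ^ (n - 1) := by
    refine IsUltrametricDist.norm_sum_le_of_forall_le_of_nonneg (by positivity) fun i hi => ?_
    have hin := Finset.mem_range.1 hi
    rw [norm_mul, norm_pow, norm_pow, hnl]
    calc _ ≤ ‖c₂‖ ^ i * ‖c₂‖ ^ (n - 1 - i) := by gcongr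
      _ = _ := by rw [← pow_add]; congr 1; omega
  have h1 : ‖c₂‖ ^ (n - 1) * ‖c₂‖ ≤ ‖c₂‖ ^ (n - 1) * ‖c₂ / l - c₁‖ := by
    rw [← pow_succ, Nat.sub_add_cancel (by omega), ← hv]
    exact mul_le_mul_of_nonneg_right hsum (norm_nonneg _)
  exact le_of_mul_le_mul_left h1 (by positivity)

end Padic

end WildBottcher

theorem theorem1p7 (p : ℕ) [Fact p.Prime] (N d : ℕ) (hd : 2 ≤ d) (c₁ c₂ : ℂ_[p])
    (hc₂ : WildBottcher.ConditionA p N d c₂ ∨ WildBottcher.ConditionB p N d c₂)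
    (hc₁ : 0 ≤ WildBottcher.vp p c₁)
    (hv : WildBottcher.vp p (c₁ ^ (d - 1) - c₂ ^ (d - 1)) =
      WildBottcher.vp p (c₂ ^ (d - 1))) :
    ¬ WildBottcher.AnalyticallyConjugate d c₁ c₂ := by
  open WildBottcher in
  obtain ⟨hpd, hc₂0, hhi, hlo⟩ := condition_bounds hd hc₂
  have hn₁ := norm_le_one_of_vp_nonneg hc₁
  rcases lt_or_ge 1 ‖c₂‖ with hn₂ | hn₂
  · exact not_conjugate_of_one_lt_norm hd hn₁ hn₂
  rintro ⟨Φ, Ψ, hbij, hinv, hΦ, hΨ, hconj⟩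
  rw [basin_eq hd hn₁] at hbij hinv hΦ hconj
  rw [basin_eq hd hn₂] at hbij hinv hΨ
  obtain ⟨l, a, A, hl, hA⟩ := exists_isBottcherSolution hd hn₁ hn₂ hΦ hconj
    fun z hz => norm_conjugacy hd hn₁ hn₂ hbij hinv hΦ hΨ hconj hz
  have he := norm_div_sub (by omega) hl (norm_eq_of_vp_eq (pow_ne_zero _ hc₂0) hv) hc₂0
  have he0 : c₂ / l - c₁ ≠ 0 := norm_pos_iff.1 (he ▸ norm_pos_iff.2 hc₂0)
  have hp := (Fact.out : p.Prime)
  have hp1 : (1 : ℝ) < p := by exact_mod_cast hp.one_lt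
  have hp0 : (0 : ℝ) < p := by linarith
  have hd1 : (0 : ℝ) < (d : ℝ) - 1 := sub_pos.2 (by exact_mod_cast hd)
  set v := -Real.logb p ‖c₂‖ with hvdef
  set m : ℝ := (padicValNat p d : ℝ) with hm
  set t : ℝ := 1 / ((p : ℝ) - 1) with ht
  have hEv : ‖c₂‖ = (p : ℝ) ^ (-v) := norm_eq_rpow hc₂0
  have hDm : ‖(d : ℂ_[p])‖ = (p : ℝ) ^ (-m) := norm_natCast (by omega)
  have hm0 : 0 < m := by
    rw [hm]; exact_mod_cast one_le_padicValNat_of_dvd (by omega) hpd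
  have hcast : ((d - 1 : ℕ) : ℝ) = (d : ℝ) - 1 := by rw [Nat.cast_sub (by omega), Nat.cast_one]
  have hdiv : m / ((d : ℝ) - 1) * ((d : ℝ) - 1) = m := div_mul_cancel₀ _ hd1.ne'
  -- `X = ρ ^ (d ^ (N + 1))`, where the `N`-th level term reaches the root gap at radius `ρ`
  refine hA.false_of_crossing hd (isRootGap (by omega) hpd) ?_ he0 N
    (X := (p : ℝ) ^ (v - t - (N + 1) * m)) ?_ (hlo.imp id fun hlo => ?_) ?_
  · rw [hDm]; exact Real.rpow_lt_one_of_one_lt_of_neg hp1 (by linarith)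
  · rw [he, hEv, hDm, ← Real.rpow_natCast ((p : ℝ) ^ (-m)), ← Real.rpow_mul hp0.le,
      ← Real.rpow_add hp0, ← Real.rpow_add hp0]
    congr 1
    push_cast
    ring
  · rw [hDm, ← Real.rpow_natCast, ← Real.rpow_natCast, ← Real.rpow_mul hp0.le,
      ← Real.rpow_mul hp0.le, hcast]
    refine Real.rpow_lt_rpow_of_exponent_lt hp1 ?_
    have := mul_lt_mul_of_pos_right hlo hd1
    nlinarith
  · rw [hDm, ← Real.rpow_natCast, ← Real.rpow_mul hp0.le, hcast]
    refine Real.rpow_lt_rpow_of_exponent_lt hp1 ?_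
    have := mul_lt_mul_of_pos_right hhi hd1
    nlinarith
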